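/- \textbf{Setting.} $\mathbb N=\{1,2,\dots\}$; $c_{00}$ is the space of finitely supported real sequences, with unit vectors $e_n$ (also written $e_n^*$ when regarded as functionals); $\langle f,x\rangle=f(x)=\sum_n f(n)x(n)$; $x<y$ means $\max\operatorname{supp}x<\min\operatorname{supp}y$; $\operatorname{range}(x)$ is the smallest interval containing $\operatorname{supp}x$. Fix positive integers $m_j,n_j$ ($j\ge1$) with $m_1=2$, $m_{j+1}=m_j^5$, $n_1=4$, $n_{j+1}=(4n_j)^{s_j}$ where $2^{s_j}\ge m_{j+1}^3$. Let $\mathbf Q$ be the set of nonzero $x\in c_{00}$ with rational coordinates of modulus at most $1$, and let $\mathbf Q_s$ be the set of sequences $(x_1,f_1,\dots,x_n,f_n)$, $n\ge1$, with $x_i,f_i\in\mathbf Q$ and $\operatorname{range}(x_i)\cup\operatorname{range}(f_i)<\operatorname{range}(x_{i+1})\cup\operatorname{range}(f_{i+1})$ for $i<n$. Fix an injection $\sigma:\mathbf Q_s\to\{2j:j\in\mathbb N\}$ such that, for all $\phi=(x_1,f_1,\dots,x_n,f_n)\in\mathbf Q_s$, $\sigma(x_1,f_1,\dots,x_{n-1},f_{n-1})<\sigma(\phi)$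 (if $n\ge2$) and $\max(\operatorname{range}(x_n)\cup\operatorname{range}(f_n))\le m_{\sigma(\phi)}^{1/2}$. For such $\phi$ write $\phi_i=(x_1,f_1,\dots,x_i,f_i)$. A sequence $\phi=(x_1,f_1,\dots,x_{2k},f_{2k})\in\mathbf Q_s$, $k\ge 1$, is \emph{special of length $2k$} if: for some $j\in\mathbb N$ with $m_{2j}^{1/2}>2k$ and some $F\subset\mathbb N$ with $\#F=n_{2j}$, $x_1=\frac1{n_{2j}}\sum_{l\in F}e_l$ and $f_1=\frac1{m_{2j}}\sum_{l\in F}e_l^*$; for $1\le i\le k$, $\|f_{2i}\|_\infty\le 1/m_{\sigma(\phi_{2i-1})}$ and $|f_{2i}(x_{2i})|\le 1/m_{\sigma(\phi_{2i-1})}$; and for $1\le i<k$ there is $F\subset\mathbb N$ with $\#F=n_{\sigma(\phi_{2i})}$, $x_{2i+1}=\frac1{n_{\sigma(\phi_{2i})}}\sum_{l\in F}e_l$ and $f_{2i+1}=\frac1{m_{\sigma(\phi_{2i})}}\sum_{l\in F}e^*_l$. Let $K_0^0=\{\pm e_n^*:n\in\mathbb N\}$, $K_0^j=\emptyset$ for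 $j\ge1$, and $K_N=\bigcup_{j\ge0}K_N^j$, where inductively, for $N\ge1$, $K_N^j\supset K_{N-1}^j$ is obtained by adding the following functionals and no others. For $j\ge1$, one adds to $K_N^{2j}$ all $\frac1{m_{2j}}\sum_{i=1}^df_i$ with $d\le n_{2j}$, $f_1<\dots<f_d$, $f_i\in K_{N-1}$. For $j\ge1$, one adds to $K_N^{2j+1}$, for each special sequence $\phi$ of length $n_{2j+1}$ with $f_{2i}\in K_{N-1}^{\sigma(\phi_{2i-1})}$ for all $1\le i\le n_{2j+1}/2$, all functionals $$\frac{\pm1}{m_{2j+1}}\,E\Big(\sum_{i=1}^{n_{2j+1}/2}\big(\lambda_{f'_{2i}}f_{2i-1}+f'_{2i}\big)\Big),$$ where $E$ is an interval of $\mathbb N$ (acting by restriction) and, for every $i$, $f'_{2i}\in K_{N-1}^{\sigma(\phi_{2i-1})}$, $\operatorname{supp}f'_{2i}=\operatorname{supp}f_{2i}$, $|g(x_{2i})|\le 1/m_{\sigma(\phi_{2i-1})}$ for all $g\in K_{N-1}^{\sigma(\phi_{2i-1})}$, and $\lambda_{f'_{2i}}=f'_{2i}(m_{\sigma(\phi_{2i-1})}x_{2i})$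 if $f'_{2i}(x_{2i})\ne0$, $\lambda_{f'_{2i}}\in\{\pm n_{2j+1}^{-2}\}$ otherwise. Put $K=\bigcup_NK_N$. The space $X_{ius}$ is the completion of $c_{00}$ under the norm $\|x\|=\sup\{f(x):f\in K\}$. Put $$\widetilde K=\{0\}\cup\{\pm e_n^*:n\in\mathbb N\}\cup\Big\{\frac1{m_{2j}}\sum_{i\in F}\pm e_i^*:\ j\in\mathbb N,\ \#F\le n_{2j}\Big\},\qquad \|x\|_{\widetilde K}=\sup\{f(x):f\in\widetilde K\}\quad(x\in c_{00}).$$ \textbf{Proposition.} For every choice of $(m_j)$, $(n_j)$ and $\sigma$ as above: (1) Let $(x_\ell)_\ell$ be a normalized block sequence in $X_{ius}$ (that is, $x_\ell\in c_{00}$, $x_1<x_2<\cdots$ and $\|x_\ell\|=1$ for all $\ell$) such that $\|x_\ell\|_{\widetilde K}\to0$. Then there is an infinite $M\subset\mathbb N$ such that the subsequence $(x_\ell)_{\ell\in M}$ is an unconditional basic sequence, i.e. an unconditional Schauder basis of its closed linear span. (2) $X_{ius}$ is unconditionally saturated: every infinite-dimensional linear subspace of $X_{ius}$ contains an unconditional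 basic sequence. -/

import Mathlib

namespace Ius

/-- The action `⟨f, x⟩` of a finitely supported functional on a finitely supported vector. -/
noncomputable def pair (f x : ℕ →₀ ℝ) : ℝ := x.sum fun k a => f k * a

/-- `x < y` : every element of the support of `x` is smaller than every element of the
support of `y`. -/
def Before (x y : ℕ →₀ ℝ) : Prop := ∀ a ∈ x.support, ∀ b ∈ y.support, a < b

open Classical in
/-- The restriction `E x` of a vector to a set `E` of coordinates. -/
noncomputable def restrict (E : Set ℕ) (x : ℕ →₀ ℝ) : ℕ →₀ ℝ := x.filter (· ∈ E)

/-- The indicator vector `∑_{l ∈ F} e_l`. -/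
noncomputable def ind (F : Finset ℕ) : ℕ →₀ ℝ := ∑ l ∈ F, Finsupp.single l 1

/-- Nonzero finitely supported vectors with rational coordinates of modulus at most one. -/
def IsQ (x : ℕ →₀ ℝ) : Prop :=
  x ≠ 0 ∧ (∀ k, ∃ q : ℚ, x k = (q : ℝ)) ∧ ∀ k, |x k| ≤ 1

/-- The sequences `(x₁, f₁, …, x_n, f_n)`, `n ≥ 1`, of elements of `Q` with
`range x_i ∪ range f_i < range x_{i+1} ∪ range f_{i+1}`, written as lists of pairs.
(All vectors are nonzero, so comparing neighbours or all pairs is the same.) -/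
def IsQs (φ : List ((ℕ →₀ ℝ) × (ℕ →₀ ℝ))) : Prop :=
  φ ≠ [] ∧ (∀ p ∈ φ, IsQ p.1 ∧ IsQ p.2) ∧
    φ.Pairwise fun p q =>
      ∀ a ∈ p.1.support ∪ p.2.support, ∀ b ∈ q.1.support ∪ q.2.support, a < b

/-- The vector `x_i` of the sequence `φ = (x₁, f₁, x₂, f₂, …)` (`i ≥ 1`). -/
noncomputable def vec (φ : List ((ℕ →₀ ℝ) × (ℕ →₀ ℝ))) (i : ℕ) : ℕ →₀ ℝ :=
  (φ.getD (i - 1) 0).1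

/-- The functional `f_i` of the sequence `φ = (x₁, f₁, x₂, f₂, …)` (`i ≥ 1`). -/
noncomputable def fnl (φ : List ((ℕ →₀ ℝ) × (ℕ →₀ ℝ))) (i : ℕ) : ℕ →₀ ℝ :=
  (φ.getD (i - 1) 0).2

/-- A choice of the sequences `(m_j)`, `(n_j)`, `j ≥ 1`, and of the coding function `σ`.
The values at `j = 0`, and the values of `σ` outside `Q_s`, are never used. -/
structure Params where
  m : ℕ → ℕ
  n : ℕ → ℕ
  σ : List ((ℕ →₀ ℝ) × (ℕ →₀ ℝ)) → ℕ
  m_one : m 1 = 2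
  m_succ : ∀ j, 1 ≤ j → m (j + 1) = m j ^ 5
  n_one : n 1 = 4
  n_succ : ∀ j, 1 ≤ j → ∃ s : ℕ, n (j + 1) = (4 * n j) ^ s ∧ m (j + 1) ^ 3 ≤ 2 ^ s
  σ_injOn : Set.InjOn σ {φ | IsQs φ}
  σ_even : ∀ φ, IsQs φ → ∃ j, 1 ≤ j ∧ σ φ = 2 * j
  /-- `σ` strictly increases when a sequence is extended by one pair. -/
  σ_lt : ∀ φ p, IsQs φ → IsQs (φ ++ [p]) → σ φ < σ (φ ++ [p])
  /-- `max (range x_n ∪ range f_n) ≤ m_{σ(φ)}^{1/2}`; coordinates are numbered from `0` here,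
  so coordinate `a` is the one in position `a + 1`. -/
  σ_large : ∀ φ p, IsQs (φ ++ [p]) → ∀ a : ℕ, a ∈ p.1.support ∪ p.2.support →
    (a : ℝ) + 1 ≤ Real.sqrt (m (σ (φ ++ [p])))

namespace Params

variable (P : Params)

/-- `φ` is a special sequence of length `2k`. Here `φ.take i` is the initial segment
`φ_i = (x₁, f₁, …, x_i, f_i)`. -/
def IsSpecial (φ : List ((ℕ →₀ ℝ) × (ℕ →₀ ℝ))) (k : ℕ) : Prop :=
  1 ≤ k ∧ IsQs φ ∧ φ.length = 2 * k ∧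
  (∃ j, 1 ≤ j ∧ 2 * (k : ℝ) < Real.sqrt (P.m (2 * j)) ∧
    ∃ F : Finset ℕ, F.card = P.n (2 * j) ∧
      vec φ 1 = (1 / (P.n (2 * j) : ℝ)) • ind F ∧
      fnl φ 1 = (1 / (P.m (2 * j) : ℝ)) • ind F) ∧
  (∀ i, 1 ≤ i → i ≤ k →
    (∀ a, |fnl φ (2 * i) a| ≤ 1 / (P.m (P.σ (φ.take (2 * i - 1))) : ℝ)) ∧
    |pair (fnl φ (2 * i)) (vec φ (2 * i))| ≤ 1 / (P.m (P.σ (φ.take (2 * i - 1))) : ℝ)) ∧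
  (∀ i, 1 ≤ i → i < k →
    ∃ F : Finset ℕ, F.card = P.n (P.σ (φ.take (2 * i))) ∧
      vec φ (2 * i + 1) = (1 / (P.n (P.σ (φ.take (2 * i))) : ℝ)) • ind F ∧
      fnl φ (2 * i + 1) = (1 / (P.m (P.σ (φ.take (2 * i))) : ℝ)) • ind F)

/-- The functionals `(1 / m_j) ∑_{i ≤ d} f_i` with `d ≤ n_j`, `f₁ < … < f_d` and `f_i ∈ A`.
(The empty sum is allowed; this only adds the zero functional.) -/
def evenStep (j : ℕ) (A : Set (ℕ →₀ ℝ)) : Set (ℕ →₀ ℝ) :=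
  {f | ∃ L : List (ℕ →₀ ℝ), L.length ≤ P.n j ∧ (∀ g ∈ L, g ∈ A) ∧ L.Pairwise Before ∧
    f = (1 / (P.m j : ℝ)) • L.sum}

/-- The functionals built on special sequences of length `n_j` (`j` odd), where `B s` stands for
the set of functionals of index `s` that has been constructed at the previous stage. The functional
`f' i` is `f'_{2i}` and `lam i` is its coefficient `λ_{f'_{2i}}`. -/
def oddStep (j : ℕ) (B : ℕ → Set (ℕ →₀ ℝ)) : Set (ℕ →₀ ℝ) :=
  {h | ∃ (φ : List ((ℕ →₀ ℝ) × (ℕ →₀ ℝ))) (k : ℕ),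
    2 * k = P.n j ∧ P.IsSpecial φ k ∧
    (∀ i, 1 ≤ i → i ≤ k → fnl φ (2 * i) ∈ B (P.σ (φ.take (2 * i - 1)))) ∧
    ∃ (ε : ℝ) (E : Set ℕ) (f' : ℕ → (ℕ →₀ ℝ)) (lam : ℕ → ℝ),
      (ε = 1 ∨ ε = -1) ∧ E.OrdConnected ∧
      (∀ i, 1 ≤ i → i ≤ k →
        (f' i).support = (fnl φ (2 * i)).support ∧
        f' i ∈ B (P.σ (φ.take (2 * i - 1))) ∧
        (∀ g ∈ B (P.σ (φ.take (2 * i - 1))),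
          |pair g (vec φ (2 * i))| ≤ 1 / (P.m (P.σ (φ.take (2 * i - 1))) : ℝ)) ∧
        (pair (f' i) (vec φ (2 * i)) ≠ 0 →
          lam i = pair (f' i) ((P.m (P.σ (φ.take (2 * i - 1))) : ℝ) • vec φ (2 * i))) ∧
        (pair (f' i) (vec φ (2 * i)) = 0 →
          lam i = 1 / (P.n j : ℝ) ^ 2 ∨ lam i = -(1 / (P.n j : ℝ) ^ 2))) ∧
      h = (ε / (P.m j : ℝ)) •
        restrict E (∑ i ∈ Finset.Icc 1 k, (lam i • fnl φ (2 * i - 1) + f' i))}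

/-- The sets `K_N^j`. -/
def level : ℕ → ℕ → Set (ℕ →₀ ℝ)
  | 0 => fun j => {f | j = 0 ∧ ∃ k, f = Finsupp.single k 1 ∨ f = Finsupp.single k (-1)}
  | N + 1 => fun j => level N j ∪
      {f | (∃ i, 1 ≤ i ∧ j = 2 * i ∧ f ∈ P.evenStep j (⋃ l, level N l)) ∨
        (∃ i, 1 ≤ i ∧ j = 2 * i + 1 ∧ f ∈ P.oddStep j (level N))}

/-- The norming set `K`. -/
def K : Set (ℕ →₀ ℝ) := ⋃ N, ⋃ j, P.level N j

/-- The set `K̃` of the functionals `± e_k` and `(1 / m_{2j}) ∑_{i ∈ F} ± e_i`, `#F ≤ n_{2j}`,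
together with `0`. -/
def Ktilde : Set (ℕ →₀ ℝ) :=
  {f | (∃ k, f = Finsupp.single k 1 ∨ f = Finsupp.single k (-1)) ∨
    (∃ (j : ℕ) (F : Finset ℕ) (ε : ℕ → ℝ), 1 ≤ j ∧ F.card ≤ P.n (2 * j) ∧
      (∀ i, ε i = 1 ∨ ε i = -1) ∧
      f = (1 / (P.m (2 * j) : ℝ)) • ∑ i ∈ F, Finsupp.single i (ε i)) ∨
    f = 0}

/-- The norm `‖x‖_K = sup {⟨f, x⟩ : f ∈ K}` of `X_ius` on `c₀₀`. -/
noncomputable def normK (x : ℕ →₀ ℝ) : ℝ := sSup ((fun f => pair f x) '' P.K)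

/-- The norm `‖x‖_K̃ = sup {⟨f, x⟩ : f ∈ K̃}` on `c₀₀`. -/
noncomputable def normKtilde (x : ℕ →₀ ℝ) : ℝ := sSup ((fun f => pair f x) '' P.Ktilde)

end Params

/-! ### `‖·‖_K` is a norm on `c₀₀` -/

theorem pair_add (f x y : ℕ →₀ ℝ) : pair f (x + y) = pair f x + pair f y :=
  Finsupp.sum_add_index' (by simp) (by intros; ring)

theorem pair_smul (f : ℕ →₀ ℝ) (c : ℝ) (x : ℕ →₀ ℝ) : pair f (c • x) = c * pair f x := by
  unfold pair
  rw [Finsupp.sum_smul_index (by simp), Finsupp.mul_sum]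
  exact Finsupp.sum_congr fun k _ => by ring

theorem pair_neg_left (f x : ℕ →₀ ℝ) : pair (-f) x = -pair f x := by
  simp [pair, Finsupp.sum]

theorem pair_single (k : ℕ) (c : ℝ) (x : ℕ →₀ ℝ) : pair (Finsupp.single k c) x = c * x k := by
  unfold pair
  rw [Finsupp.sum, Finset.sum_eq_single k]
  · simp
  · intro b _ hb
    simp [hb.symm]
  · intro h
    simp [Finsupp.notMem_support_iff.mp h]

theorem abs_pair_le {f : ℕ →₀ ℝ} (hf : ∀ k, |f k| ≤ 1) (x : ℕ →₀ ℝ) :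
    |pair f x| ≤ ∑ k ∈ x.support, |x k| := by
  unfold pair
  rw [Finsupp.sum]
  refine (Finset.abs_sum_le_sum_abs _ _).trans (Finset.sum_le_sum fun k _ => ?_)
  rw [abs_mul]
  exact mul_le_of_le_one_left (abs_nonneg _) (hf k)

/-- At each point at most one term of the sum is nonzero, so the sum inherits their bound. -/
theorem abs_sum_le_one {ι : Type*} (s : Finset ι) (u : ι → ℝ) (h1 : ∀ i ∈ s, |u i| ≤ 1)
    (h2 : ∀ i ∈ s, ∀ j ∈ s, u i ≠ 0 → u j ≠ 0 → i = j) : |∑ i ∈ s, u i| ≤ 1 := by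
  by_cases h : ∃ i ∈ s, u i ≠ 0
  · obtain ⟨i, hi, hne⟩ := h
    rw [Finset.sum_eq_single_of_mem i hi]
    · exact h1 i hi
    · intro j hj hji
      by_contra hj0
      exact hji (h2 j hj i hi hj0 hne)
  · push Not at h
    rw [Finset.sum_eq_zero h]
    simp

theorem abs_list_sum_le_one (L : List (ℕ →₀ ℝ)) (h1 : ∀ g ∈ L, ∀ a, |g a| ≤ 1)
    (h2 : L.Pairwise Before) (a : ℕ) : |L.sum a| ≤ 1 := by
  induction L with
  | nil => simp
  | cons g L ih =>
    rw [List.pairwise_cons] at h2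
    rw [List.sum_cons, Finsupp.add_apply]
    by_cases hg : g a = 0
    · rw [hg, zero_add]
      exact ih (fun g' hg' => h1 g' (List.mem_cons_of_mem _ hg')) h2.2
    · have h0 : ∀ L' : List (ℕ →₀ ℝ), (∀ g' ∈ L', Before g g') → L'.sum a = 0 := by
        intro L' hL'
        induction L' with
        | nil => simp
        | cons g' L' ih' =>
          rw [List.sum_cons, Finsupp.add_apply,
            ih' fun g'' h'' => hL' g'' (List.mem_cons_of_mem _ h''), add_zero]
          by_contra hne
          exact lt_irrefl a (hL' g' List.mem_cons_self a (Finsupp.mem_support_iff.mpr hg) a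
            (Finsupp.mem_support_iff.mpr hne))
      rw [h0 L h2.1, add_zero]
      exact h1 g List.mem_cons_self a

namespace Params

variable (P : Params)

theorem one_le_m (j : ℕ) (hj : 1 ≤ j) : 1 ≤ P.m j := by
  induction j, hj using Nat.le_induction with
  | base => simp [P.m_one]
  | succ j hj ih => rw [P.m_succ j hj]; exact Nat.one_le_pow _ _ ih

theorem abs_evenStep_le {j : ℕ} (hj : 1 ≤ j) {A : Set (ℕ →₀ ℝ)}
    (hA : ∀ g ∈ A, ∀ a, |g a| ≤ 1) {f : ℕ →₀ ℝ} (hf : f ∈ P.evenStep j A) (a : ℕ) :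
    |f a| ≤ 1 := by
  obtain ⟨L, -, hLA, hL, rfl⟩ := hf
  have hm : (1 : ℝ) ≤ P.m j := by exact_mod_cast P.one_le_m j hj
  have h := abs_list_sum_le_one L (fun g hg => hA g (hLA g hg)) hL a
  rw [Finsupp.smul_apply, smul_eq_mul, abs_mul]
  refine mul_le_one₀ ?_ (abs_nonneg _) h
  rw [abs_of_nonneg (by positivity)]
  exact (div_le_one (by linarith)).mpr hm

theorem abs_oddStep_le {j : ℕ} (hj : 1 ≤ j) {B : ℕ → Set (ℕ →₀ ℝ)}
    (hB : ∀ s, ∀ g ∈ B s, ∀ a, |g a| ≤ 1) {h : ℕ →₀ ℝ} (hh : h ∈ P.oddStep j B) (a : ℕ) :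
    |h a| ≤ 1 := by
  classical
  obtain ⟨φ, k, hk, hφ, -, ε, E, f', lam, hε, -, hf', rfl⟩ := hh
  obtain ⟨hk1, ⟨-, hQ, hpw⟩, hlen, -, -, -⟩ := hφ
  have hm : (1 : ℝ) ≤ P.m j := by exact_mod_cast P.one_le_m j hj
  have hget : ∀ i, 1 ≤ i → i ≤ 2 * k → ∃ h : i - 1 < φ.length, fnl φ i = (φ[i - 1]).2 := by
    intro i h1 h2
    refine ⟨by omega, ?_⟩
    unfold fnl
    rw [List.getD_eq_getElem]
  have hord : ∀ i i', 1 ≤ i → i < i' → i' ≤ 2 * k → fnl φ i a ≠ 0 → fnl φ i' a ≠ 0 → False := by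
    intro i i' h1 h2 h3 h4 h5
    obtain ⟨l1, e1⟩ := hget i h1 (by omega)
    obtain ⟨l2, e2⟩ := hget i' (by omega) h3
    rw [e1] at h4
    rw [e2] at h5
    have := List.pairwise_iff_getElem.mp hpw (i - 1) (i' - 1) l1 l2 (by omega) a
      (Finset.mem_union_right _ (Finsupp.mem_support_iff.mpr h4)) a
      (Finset.mem_union_right _ (Finsupp.mem_support_iff.mpr h5))
    exact lt_irrefl a this
  have hdisj : ∀ i i', 1 ≤ i → i ≤ 2 * k → 1 ≤ i' → i' ≤ 2 * k → fnl φ i a ≠ 0 →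
      fnl φ i' a ≠ 0 → i = i' := by
    intro i i' h1 h2 h3 h4 h5 h6
    rcases lt_trichotomy i i' with h | h | h
    · exact (hord i i' h1 h h4 h5 h6).elim
    · exact h
    · exact (hord i' i h3 h h2 h6 h5).elim
  have hsupp : ∀ i, 1 ≤ i → i ≤ k → f' i a ≠ 0 → fnl φ (2 * i) a ≠ 0 := by
    intro i h1 h2 h3
    rw [← Finsupp.mem_support_iff, ← (hf' i h1 h2).1, Finsupp.mem_support_iff]
    exact h3
  have hlam : ∀ i, 1 ≤ i → i ≤ k → |lam i| ≤ 1 := by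
    intro i h1 h2
    obtain ⟨-, hmem, hbd, hne, he⟩ := hf' i h1 h2
    by_cases h0 : pair (f' i) (vec φ (2 * i)) = 0
    · have hn : (1 : ℝ) ≤ (P.n j : ℝ) ^ 2 := by
        have : (1 : ℝ) ≤ P.n j := by
          have : 1 ≤ P.n j := by omega
          exact_mod_cast this
        exact one_le_pow₀ this
      have : |1 / (P.n j : ℝ) ^ 2| ≤ 1 := by
        rw [abs_of_nonneg (by positivity)]
        exact (div_le_one (by linarith)).mpr hn
      rcases he h0 with e | e <;> rw [e]
      · exact this
      · rwa [abs_neg]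
    · rw [hne h0, pair_smul, abs_mul, abs_of_nonneg (Nat.cast_nonneg _)]
      have := mul_le_mul_of_nonneg_left (hbd _ hmem)
        (Nat.cast_nonneg (α := ℝ) (P.m (P.σ (φ.take (2 * i - 1)))))
      refine this.trans ?_
      rw [mul_one_div]
      exact div_self_le_one _
  have hsum : |∑ i ∈ Finset.Icc 1 k, (lam i • fnl φ (2 * i - 1) + f' i) a| ≤ 1 := by
    refine abs_sum_le_one _ _ ?_ ?_
    · intro i hi
      rw [Finset.mem_Icc] at hi
      rw [Finsupp.add_apply, Finsupp.smul_apply, smul_eq_mul]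
      by_cases h0 : f' i a = 0
      · rw [h0, add_zero, abs_mul]
        refine mul_le_one₀ (hlam i hi.1 hi.2) (abs_nonneg _) ?_
        obtain ⟨l1, e1⟩ := hget (2 * i - 1) (by omega) (by omega)
        rw [e1]
        exact (hQ _ (List.getElem_mem l1)).2.2.2 a
      · have : fnl φ (2 * i - 1) a = 0 := by
          by_contra h1
          have := hdisj (2 * i - 1) (2 * i) (by omega) (by omega) (by omega) (by omega) h1
            (hsupp i hi.1 hi.2 h0)
          omega
        rw [this, mul_zero, zero_add]
        exact hB _ _ (hf' i hi.1 hi.2).2.1 a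
    · have hor : ∀ i ∈ Finset.Icc 1 k, (lam i • fnl φ (2 * i - 1) + f' i) a ≠ 0 →
          ∃ t, 1 ≤ t ∧ t ≤ 2 * k ∧ fnl φ t a ≠ 0 ∧ (t = 2 * i - 1 ∨ t = 2 * i) := by
        intro i hi hne
        rw [Finset.mem_Icc] at hi
        by_cases h0 : f' i a = 0
        · refine ⟨2 * i - 1, by omega, by omega, ?_, Or.inl rfl⟩
          intro h1
          apply hne
          simp [h0, h1]
        · exact ⟨2 * i, by omega, by omega, hsupp i hi.1 hi.2 h0, Or.inr rfl⟩
      intro i hi i' hi' h1 h2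
      obtain ⟨t, ht1, ht2, ht3, ht4⟩ := hor i hi h1
      obtain ⟨t', ht1', ht2', ht3', ht4'⟩ := hor i' hi' h2
      have := hdisj t t' ht1 ht2 ht1' ht2' ht3 ht3'
      rw [Finset.mem_Icc] at hi hi'
      omega
  rw [Finsupp.smul_apply, smul_eq_mul, abs_mul]
  refine mul_le_one₀ ?_ (abs_nonneg _) ?_
  · rw [abs_div, Nat.abs_cast]
    have : |ε| = 1 := by rcases hε with e | e <;> simp [e]
    rw [this]
    exact (div_le_one (by linarith)).mpr hm
  · unfold restrict
    rw [Finsupp.filter_apply]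
    split_ifs
    · rwa [Finsupp.finsetSum_apply]
    · simp

theorem abs_level_le (N : ℕ) : ∀ j, ∀ f ∈ P.level N j, ∀ a, |f a| ≤ 1 := by
  induction N with
  | zero =>
    rintro j f ⟨-, k, rfl | rfl⟩ a <;> rw [Finsupp.single_apply] <;> split_ifs <;> simp
  | succ N ih =>
    rintro j f (hf | ⟨i, hi, hj, hf⟩ | ⟨i, hi, hj, hf⟩) a
    · exact ih j f hf a
    · refine P.abs_evenStep_le (by omega) ?_ hf a
      intro g hg
      obtain ⟨l, hl⟩ := Set.mem_iUnion.mp hg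
      exact ih l g hl
    · exact P.abs_oddStep_le (by omega) ih hf a

theorem abs_K_le {f : ℕ →₀ ℝ} (hf : f ∈ P.K) (a : ℕ) : |f a| ≤ 1 := by
  simp only [K, Set.mem_iUnion] at hf
  obtain ⟨N, j, h⟩ := hf
  exact P.abs_level_le N j f h a

theorem single_mem_K (k : ℕ) (c : ℝ) (hc : c = 1 ∨ c = -1) : Finsupp.single k c ∈ P.K := by
  simp only [K, Set.mem_iUnion]
  exact ⟨0, 0, rfl, k, by rcases hc with rfl | rfl <;> simp⟩

theorem evenStep_neg {j : ℕ} {A : Set (ℕ →₀ ℝ)} (hA : ∀ g ∈ A, -g ∈ A) {f : ℕ →₀ ℝ}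
    (hf : f ∈ P.evenStep j A) : -f ∈ P.evenStep j A := by
  obtain ⟨L, hl, hLA, hL, rfl⟩ := hf
  refine ⟨L.map (fun g => -g), by simpa using hl, ?_, ?_, ?_⟩
  · intro g hg
    obtain ⟨g', h', rfl⟩ := List.mem_map.mp hg
    exact hA g' (hLA g' h')
  · rw [List.pairwise_map]
    exact hL.imp fun h => by simpa [Before] using h
  · rw [← smul_neg, List.sum_neg]

theorem oddStep_neg {j : ℕ} {B : ℕ → Set (ℕ →₀ ℝ)} {f : ℕ →₀ ℝ}
    (hf : f ∈ P.oddStep j B) : -f ∈ P.oddStep j B := by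
  obtain ⟨φ, k, hk, hφ, hB, ε, E, f', lam, hε, hE, hf', rfl⟩ := hf
  refine ⟨φ, k, hk, hφ, hB, -ε, E, f', lam, ?_, hE, hf', ?_⟩
  · rcases hε with rfl | rfl <;> simp
  · rw [neg_div, neg_smul]

theorem level_neg (N : ℕ) : ∀ j, ∀ f ∈ P.level N j, -f ∈ P.level N j := by
  induction N with
  | zero =>
    rintro j f ⟨hj, k, rfl | rfl⟩
    · exact ⟨hj, k, Or.inr (by rw [Finsupp.single_neg])⟩
    · exact ⟨hj, k, Or.inl (by rw [Finsupp.single_neg, neg_neg])⟩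
  | succ N ih =>
    rintro j f (hf | ⟨i, hi, hj, hf⟩ | ⟨i, hi, hj, hf⟩)
    · exact Or.inl (ih j f hf)
    · refine Or.inr (Or.inl ⟨i, hi, hj, P.evenStep_neg ?_ hf⟩)
      intro g hg
      obtain ⟨l, hl⟩ := Set.mem_iUnion.mp hg
      exact Set.mem_iUnion.mpr ⟨l, ih l g hl⟩
    · exact Or.inr (Or.inr ⟨i, hi, hj, P.oddStep_neg hf⟩)

theorem K_neg {f : ℕ →₀ ℝ} (hf : f ∈ P.K) : -f ∈ P.K := by
  simp only [K, Set.mem_iUnion] at hf ⊢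
  obtain ⟨N, j, h⟩ := hf
  exact ⟨N, j, P.level_neg N j f h⟩

theorem bddAbove_K (x : ℕ →₀ ℝ) : BddAbove ((fun f => pair f x) '' P.K) := by
  refine ⟨∑ k ∈ x.support, |x k|, ?_⟩
  rintro _ ⟨f, hf, rfl⟩
  exact (le_abs_self _).trans (abs_pair_le (P.abs_K_le hf) x)

theorem pair_le_normK {f : ℕ →₀ ℝ} (hf : f ∈ P.K) (x : ℕ →₀ ℝ) : pair f x ≤ P.normK x :=
  le_csSup (P.bddAbove_K x) ⟨f, hf, rfl⟩

theorem abs_pair_le_normK {f : ℕ →₀ ℝ} (hf : f ∈ P.K) (x : ℕ →₀ ℝ) :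
    |pair f x| ≤ P.normK x := by
  refine abs_le'.mpr ⟨P.pair_le_normK hf x, ?_⟩
  rw [← pair_neg_left]
  exact P.pair_le_normK (P.K_neg hf) x

theorem normK_le {x : ℕ →₀ ℝ} {c : ℝ} (h : ∀ f ∈ P.K, pair f x ≤ c) : P.normK x ≤ c := by
  refine csSup_le ⟨_, _, P.single_mem_K 0 1 (Or.inl rfl), rfl⟩ ?_
  rintro _ ⟨f, hf, rfl⟩
  exact h f hf

theorem normK_nonneg (x : ℕ →₀ ℝ) : 0 ≤ P.normK x :=
  (abs_nonneg _).trans (P.abs_pair_le_normK (P.single_mem_K 0 1 (Or.inl rfl)) x)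

theorem normK_smul_le (c : ℝ) (x : ℕ →₀ ℝ) : P.normK (c • x) ≤ |c| * P.normK x := by
  refine P.normK_le fun f hf => ?_
  rw [pair_smul]
  refine (le_abs_self _).trans ?_
  rw [abs_mul]
  exact mul_le_mul_of_nonneg_left (P.abs_pair_le_normK hf x) (abs_nonneg _)

/-- The vector space `c₀₀`, to be normed by `‖·‖_K`. -/
def C00 (_P : Params) : Type := ℕ →₀ ℝ

noncomputable instance : AddCommGroup P.C00 := inferInstanceAs (AddCommGroup (ℕ →₀ ℝ))

noncomputable instance : Module ℝ P.C00 := inferInstanceAs (Module ℝ (ℕ →₀ ℝ))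

noncomputable instance : Norm P.C00 := ⟨fun x => P.normK x⟩

theorem core : NormedSpace.Core ℝ P.C00 where
  norm_nonneg x := P.normK_nonneg x
  norm_smul c x := by
    change P.normK (c • (show ℕ →₀ ℝ from x)) = |c| * P.normK x
    refine le_antisymm (P.normK_smul_le c x) ?_
    by_cases hc : c = 0
    · rw [hc, abs_zero, zero_mul]
      exact P.normK_nonneg _
    · have h := P.normK_smul_le c⁻¹ (c • (show ℕ →₀ ℝ from x))
      rw [inv_smul_smul₀ hc, abs_inv] at h
      have hc' : 0 < |c| := abs_pos.mpr hc
      calc |c| * P.normK x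
          ≤ |c| * (|c|⁻¹ * P.normK (c • (show ℕ →₀ ℝ from x))) :=
            mul_le_mul_of_nonneg_left h hc'.le
        _ = P.normK (c • (show ℕ →₀ ℝ from x)) := by field_simp
  norm_triangle x y := by
    refine P.normK_le fun f hf => ?_
    exact (pair_add f x y).le.trans
      (add_le_add (P.pair_le_normK hf x) (P.pair_le_normK hf y))
  norm_eq_zero_iff x := by
    constructor
    · intro h
      refine Finsupp.ext fun k => ?_
      have h1 := P.abs_pair_le_normK (P.single_mem_K k 1 (Or.inl rfl)) x
      have h2 : pair (Finsupp.single k 1) (show ℕ →₀ ℝ from x) = (show ℕ →₀ ℝ from x) k := by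
        rw [pair_single, one_mul]
      exact abs_nonpos_iff.mp ((congrArg abs h2).ge.trans (h1.trans (le_of_eq h)))
    · rintro rfl
      refine le_antisymm (P.normK_le fun f _ => ?_) (P.normK_nonneg _)
      exact le_of_eq (Finsupp.sum_zero_index)

noncomputable instance : NormedAddCommGroup P.C00 := NormedAddCommGroup.ofCore P.core

noncomputable instance : NormedSpace ℝ P.C00 := NormedSpace.ofCore P.core

/-- The space `X_ius`: the completion of `(c₀₀, ‖·‖_K)`. -/
abbrev X : Type := UniformSpace.Completion P.C00

/-- The canonical inclusion of `c₀₀` in `X_ius`. -/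
noncomputable def toX (x : ℕ →₀ ℝ) : P.X := ((show P.C00 from x) : UniformSpace.Completion P.C00)

/-- The norm of `X_ius` extends `‖·‖_K`. -/
theorem norm_toX (x : ℕ →₀ ℝ) : ‖P.toX x‖ = P.normK x :=
  UniformSpace.Completion.norm_coe (show P.C00 from x)

end Params

/-- A block sequence in `c₀₀`: nonzero vectors with `x_0 < x_1 < x_2 < …`. -/
def IsBlockSeq (x : ℕ → (ℕ →₀ ℝ)) : Prop :=
  (∀ l, x l ≠ 0) ∧ ∀ l, Before (x l) (x (l + 1))

/-- `y` is an unconditional basic sequence: it is an unconditional Schauder basis of its closed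
linear span. -/
def IsUnconditionalBasicSeq {E : Type*} [NormedAddCommGroup E] [NormedSpace ℝ E]
    (y : ℕ → E) : Prop :=
  ∃ b : UnconditionalSchauderBasis ℕ ℝ (Submodule.span ℝ (Set.range y)).topologicalClosure,
    ∀ n, ((b.basis n : (Submodule.span ℝ (Set.range y)).topologicalClosure) : E) = y n

end Ius

/-! Unconditionality comes from a sign-changing principle for the norming set. Given blocks `x l`
and arbitrary signs `ε l`, every `f ∈ K` has a partner `g ∈ K` with `|g(x l) - ε l f(x l)| ≤ ‖x
l‖_K̃` for all `l` (`exists_flip_K`). When the blocks are normalized, each coefficient of a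
combination is at most its norm, so if the K̃-norms are summable, averaging `f` and `g` bounds all
coordinate projections (`normK_sum_subset_le`). Part (1) follows by passing to a subsequence.

The principle is proved by induction on the level `N`, in a stronger form. To be admissible inside a
special functional, `g` must keep the index and the support of `f`. To keep errors from
accumulating, `g` must equal `ε l • f` whenever `f` lives in the hull of `x l`. Then, among
successive functionals, only the at most two that meet `x l` and stick out of its hull contribute an
error. In a special functional the special sequence is kept and only the `f'_{2i}` are flipped; the
coefficient `λ` follows. It can fail to pick up the sign only if `f'_{2i}` is not in the hull, and
for at most one such `i` does `f_{2i-1}` meet `x l`. As `f_{2i-1} ∈ K̃`, this costs `2‖x l‖_K̃`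
more, and the total `4‖x l‖_K̃` is absorbed by `1 / m_j ≤ 1 / 4`.

For part (2), normalized vectors of small K̃-norm are found near any infinite-dimensional subspace
by averaging twice. A normalized sum of `n_{2j}` blocks carries a factor at most `2 / m_{2j}`, so
its sup norm is small. Blocks with rapidly decreasing sup norms then behave like the basis of `c₀`
under K̃ (`pair_sum_le_three`), so a second normalized sum has small K̃-norm. A perturbation moves
the resulting sequence into the subspace. -/

namespace Ius

/-! ### Unconditional basic sequences: criterion and stability -/

/-- Nonzero vectors whose coordinate projections are uniformly bounded on finite linear
combinations form an unconditional basic sequence. -/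
theorem IsUnconditionalBasicSeq.of_bound {E : Type*} [NormedAddCommGroup E] [NormedSpace ℝ E]
    {y : ℕ → E} (hy : ∀ n, y n ≠ 0) {C : ℝ} (h : ∀ (s A : Finset ℕ), A ⊆ s → ∀ a : ℕ → ℝ,
      ‖∑ i ∈ A, a i • y i‖ ≤ C * ‖∑ i ∈ s, a i • y i‖) : IsUnconditionalBasicSeq y := by
  classical
  have hC0 : 0 ≤ C := by
    have h1 := h {0} {0} subset_rfl (fun _ => 1)
    simp only [Finset.sum_singleton, one_smul] at h1
    by_contra hC
    exact absurd (h1.trans (mul_nonpos_of_nonpos_of_nonneg (not_le.mp hC).le (norm_nonneg _)))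
      (not_le.mpr (norm_pos_iff.mpr (hy 0)))
  set V := (Submodule.span ℝ (Set.range y)).topologicalClosure with hV
  have hmem : ∀ n, y n ∈ V := fun n =>
    Submodule.le_topologicalClosure _ (Submodule.subset_span ⟨n, rfl⟩)
  let b : ℕ → V := fun n => ⟨y n, hmem n⟩
  let e : (ℕ →₀ ℝ) →ₗ[ℝ] V := Finsupp.linearCombination ℝ b
  have he : ∀ c : ℕ →₀ ℝ, ((e c : V) : E) = ∑ i ∈ c.support, c i • y i := by
    intro c
    simp [e, Finsupp.linearCombination_apply, Finsupp.sum, b]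
  have hdense : DenseRange e := by
    rw [Metric.denseRange_iff]
    rintro ⟨v, hv⟩ r hr
    obtain ⟨w, hw, hvw⟩ := Metric.mem_closure_iff.mp hv r hr
    obtain ⟨c, rfl⟩ := Finsupp.mem_span_range_iff_exists_finsupp.mp hw
    refine ⟨c, ?_⟩
    rw [Subtype.dist_eq, he]
    exact hvw
  have hpart : ∀ (c : ℕ →₀ ℝ) (A : Finset ℕ), ‖∑ i ∈ A, c i • b i‖ ≤ C * ‖e c‖ := by
    intro c A
    have h1 : ∑ i ∈ A, c i • b i = ∑ i ∈ A ∩ c.support, c i • b i := by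
      refine (Finset.sum_subset Finset.inter_subset_left fun i hi hi' => ?_).symm
      have : c i = 0 := by
        by_contra h0
        exact hi' (Finset.mem_inter.mpr ⟨hi, Finsupp.mem_support_iff.mpr h0⟩)
      rw [this, zero_smul]
    have h2 := h c.support (A ∩ c.support) Finset.inter_subset_right c
    rw [← he c] at h2
    rw [h1]
    refine le_of_eq_of_le ?_ h2
    rw [← Submodule.norm_coe]
    simp [b]
  have hcoord : ∀ i, ∃ D, ∀ c : ℕ →₀ ℝ, ‖(Finsupp.lapply i : (ℕ →₀ ℝ) →ₗ[ℝ] ℝ) c‖ ≤ D * ‖e c‖ := by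
    intro i
    refine ⟨C / ‖y i‖, fun c => ?_⟩
    have h1 := hpart c {i}
    rw [Finset.sum_singleton, norm_smul] at h1
    have h2 : (0 : ℝ) < ‖y i‖ := norm_pos_iff.mpr (hy i)
    rw [div_mul_eq_mul_div, le_div_iff₀ h2]
    exact h1
  -- Coordinates are bounded on finite combinations, which are dense in the closed span, so they
  -- extend to it.
  let f : ℕ → StrongDual ℝ V := fun i => (Finsupp.lapply i : (ℕ →₀ ℝ) →ₗ[ℝ] ℝ).extendOfNorm e
  have hf : ∀ i c, f i (e c) = c i := fun i c =>
    LinearMap.extendOfNorm_eq hdense (hcoord i) c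
  have hproj : ∀ (A : Finset ℕ) (v : V), ‖∑ i ∈ A, f i v • b i‖ ≤ C * ‖v‖ := by
    intro A v
    refine hdense.induction_on (p := fun v => ‖∑ i ∈ A, f i v • b i‖ ≤ C * ‖v‖) v
      (isClosed_le (by fun_prop) (by fun_prop)) fun c => ?_
    simp only [hf]
    exact hpart c A
  refine ⟨⟨b, f, ?_, ?_⟩, fun n => rfl⟩
  · intro i j
    have : b j = e (Finsupp.single j 1) := by simp [e]
    rw [this, hf]
    by_cases hij : i = j
    · subst hij
      rw [Finsupp.single_eq_same]
      simp
    · rw [Finsupp.single_eq_of_ne hij]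
      simp [hij]
  · intro v
    rw [HasSum, SummationFilter.unconditional_filter, Metric.tendsto_atTop]
    intro r hr
    -- Every projection onto a finite set containing the support of `c` fixes `e c`, so only the
    -- remainder `v - e c` matters; projection minus identity has norm at most `C + 1`.
    obtain ⟨c, hc⟩ := Metric.denseRange_iff.mp hdense v (r / (C + 1)) (by positivity)
    refine ⟨c.support, fun A hA => ?_⟩
    have h1 : ∑ i ∈ A, f i (e c) • b i = e c := by
      simp only [hf]
      rw [← Finset.sum_subset hA]
      · simp [e, Finsupp.linearCombination_apply, Finsupp.sum]
      · intro i _ hi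
        rw [Finsupp.notMem_support_iff.mp hi, zero_smul]
    have h2 : ∑ i ∈ A, f i v • b i - v = ∑ i ∈ A, f i (v - e c) • b i - (v - e c) := by
      simp only [map_sub, sub_smul, Finset.sum_sub_distrib, h1]
      abel
    rw [dist_eq_norm, h2]
    rw [dist_eq_norm] at hc
    calc ‖∑ i ∈ A, f i (v - e c) • b i - (v - e c)‖
        ≤ C * ‖v - e c‖ + ‖v - e c‖ := (norm_sub_le _ _).trans (by gcongr; exact hproj A _)
      _ = (C + 1) * ‖v - e c‖ := by ring
      _ < (C + 1) * (r / (C + 1)) := by gcongr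
      _ = r := by field_simp

/-- Stability of the hypothesis of `IsUnconditionalBasicSeq.of_bound` under small perturbations of
a normalized sequence. -/
theorem projection_bound_of_perturbation {E : Type*} [NormedAddCommGroup E] [NormedSpace ℝ E]
    {x y : ℕ → E} {C : ℝ} (hC : 0 ≤ C) (hx : ∀ (s A : Finset ℕ), A ⊆ s → ∀ a : ℕ → ℝ,
      ‖∑ i ∈ A, a i • x i‖ ≤ C * ‖∑ i ∈ s, a i • x i‖)
    (hcoef : ∀ (s : Finset ℕ) (a : ℕ → ℝ), ∀ i ∈ s, |a i| ≤ ‖∑ i ∈ s, a i • x i‖)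
    {τ : ℕ → ℝ} (hτ : ∀ i, ‖x i - y i‖ ≤ τ i) (hsum : ∀ s : Finset ℕ, ∑ i ∈ s, τ i ≤ 1 / 2)
    (s A : Finset ℕ) (hA : A ⊆ s) (a : ℕ → ℝ) :
    ‖∑ i ∈ A, a i • y i‖ ≤ (2 * C + 1) * ‖∑ i ∈ s, a i • y i‖ := by
  have key : ∀ B ⊆ s, ‖∑ i ∈ B, a i • x i - ∑ i ∈ B, a i • y i‖ ≤
      1 / 2 * ‖∑ i ∈ s, a i • x i‖ := by
    intro B hB
    rw [← Finset.sum_sub_distrib]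
    calc ‖∑ i ∈ B, (a i • x i - a i • y i)‖
        ≤ ∑ i ∈ B, ‖∑ i ∈ s, a i • x i‖ * τ i := by
          refine (norm_sum_le _ _).trans (Finset.sum_le_sum fun i hi => ?_)
          rw [← smul_sub, norm_smul]
          exact mul_le_mul (hcoef s a i (hB hi)) (hτ i) (norm_nonneg _) (norm_nonneg _)
      _ = (∑ i ∈ B, τ i) * ‖∑ i ∈ s, a i • x i‖ := by rw [← Finset.mul_sum, mul_comm]
      _ ≤ _ := by gcongr; exact hsum B
  have h1 := key s subset_rfl
  have h2 := key A hA
  have h3 := hx s A hA a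
  have h4 := norm_le_norm_add_norm_sub' (∑ i ∈ s, a i • x i) (∑ i ∈ s, a i • y i)
  have h5 := norm_le_norm_add_norm_sub (∑ i ∈ A, a i • x i) (∑ i ∈ A, a i • y i)
  have h6 : ‖∑ i ∈ s, a i • x i‖ ≤ 2 * ‖∑ i ∈ s, a i • y i‖ := by linarith
  nlinarith

/-! ### Pairing and restriction -/

theorem pair_eq_sum (f x : ℕ →₀ ℝ) : pair f x = ∑ k ∈ x.support, f k * x k := rfl

theorem pair_add_left (f g x : ℕ →₀ ℝ) : pair (f + g) x = pair f x + pair g x := by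
  simp [pair_eq_sum, add_mul, Finset.sum_add_distrib]

theorem pair_smul_left (c : ℝ) (f x : ℕ →₀ ℝ) : pair (c • f) x = c * pair f x := by
  simp [pair_eq_sum, mul_assoc, Finset.mul_sum]

theorem pair_zero_left (x : ℕ →₀ ℝ) : pair 0 x = 0 := by simp [pair_eq_sum]

theorem pair_sum_left {ι : Type*} (s : Finset ι) (f : ι → (ℕ →₀ ℝ)) (x : ℕ →₀ ℝ) :
    pair (∑ i ∈ s, f i) x = ∑ i ∈ s, pair (f i) x := by
  classical
  induction s using Finset.induction_on with
  | empty => simp [pair_zero_left]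
  | insert i s hi ih => rw [Finset.sum_insert hi, Finset.sum_insert hi, pair_add_left, ih]

theorem pair_sum {ι : Type*} (f : ℕ →₀ ℝ) (s : Finset ι) (x : ι → (ℕ →₀ ℝ)) :
    pair f (∑ i ∈ s, x i) = ∑ i ∈ s, pair f (x i) := by
  classical
  induction s using Finset.induction_on with
  | empty => simp [pair_eq_sum]
  | insert i s hi ih => rw [Finset.sum_insert hi, Finset.sum_insert hi, pair_add, ih]

theorem pair_eq_zero {f x : ℕ →₀ ℝ} (h : ∀ k ∈ x.support, k ∉ f.support) : pair f x = 0 :=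
  Finset.sum_eq_zero fun k hk => by
    simp only [Finsupp.notMem_support_iff.mp (h k hk), zero_mul]

theorem restrict_apply_of_mem {E : Set ℕ} {k : ℕ} (hk : k ∈ E) (f : ℕ →₀ ℝ) :
    restrict E f k = f k := by
  rw [restrict, Finsupp.filter_apply, if_pos hk]

theorem restrict_apply_of_notMem {E : Set ℕ} {k : ℕ} (hk : k ∉ E) (f : ℕ →₀ ℝ) :
    restrict E f k = 0 := by
  rw [restrict, Finsupp.filter_apply, if_neg hk]

theorem mem_support_restrict {E : Set ℕ} {f : ℕ →₀ ℝ} {k : ℕ} :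
    k ∈ (restrict E f).support ↔ k ∈ f.support ∧ k ∈ E := by
  classical
  by_cases hk : k ∈ E <;> simp [restrict_apply_of_mem, restrict_apply_of_notMem, hk]

theorem restrict_zero (E : Set ℕ) : restrict E 0 = 0 := by
  ext k
  by_cases hk : k ∈ E <;> simp [restrict_apply_of_mem, restrict_apply_of_notMem, hk]

theorem restrict_add (E : Set ℕ) (f g : ℕ →₀ ℝ) :
    restrict E (f + g) = restrict E f + restrict E g := by
  ext k
  by_cases hk : k ∈ E <;> simp [restrict_apply_of_mem, restrict_apply_of_notMem, hk]

theorem restrict_smul (E : Set ℕ) (c : ℝ) (f : ℕ →₀ ℝ) :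
    restrict E (c • f) = c • restrict E f := by
  ext k
  by_cases hk : k ∈ E <;> simp [restrict_apply_of_mem, restrict_apply_of_notMem, hk]

theorem restrict_sum {ι : Type*} (E : Set ℕ) (s : Finset ι) (f : ι → (ℕ →₀ ℝ)) :
    restrict E (∑ i ∈ s, f i) = ∑ i ∈ s, restrict E (f i) := by
  classical
  induction s using Finset.induction_on with
  | empty => exact restrict_zero E
  | insert i s hi ih => rw [Finset.sum_insert hi, Finset.sum_insert hi, restrict_add, ih]

theorem restrict_restrict (E F : Set ℕ) (f : ℕ →₀ ℝ) :
    restrict E (restrict F f) = restrict (E ∩ F) f := by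
  ext k
  by_cases hE : k ∈ E <;> by_cases hF : k ∈ F <;>
    simp [restrict_apply_of_mem, restrict_apply_of_notMem, hE, hF]

theorem restrict_eq_self {E : Set ℕ} {f : ℕ →₀ ℝ} (h : ∀ k ∈ f.support, k ∈ E) :
    restrict E f = f := by
  ext k
  by_cases hk : k ∈ E
  · exact restrict_apply_of_mem hk f
  · rw [restrict_apply_of_notMem hk]
    exact (Finsupp.notMem_support_iff.mp fun h' => hk (h k h')).symm

theorem restrict_eq_zero {E : Set ℕ} {f : ℕ →₀ ℝ} (h : ∀ k ∈ f.support, k ∉ E) :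
    restrict E f = 0 := by
  ext k
  by_cases hk : k ∈ E
  · rw [restrict_apply_of_mem hk]
    exact Finsupp.notMem_support_iff.mp fun h' => h k h' hk
  · exact restrict_apply_of_notMem hk f

theorem pair_restrict (E : Set ℕ) (f x : ℕ →₀ ℝ) :
    pair (restrict E f) x = pair f (restrict E x) := by
  have h : (restrict E x).support ⊆ x.support := fun k hk => (mem_support_restrict.mp hk).1
  rw [pair_eq_sum, pair_eq_sum, Finset.sum_subset h]
  · refine Finset.sum_congr rfl fun k _ => ?_
    by_cases hk : k ∈ E <;> simp [restrict_apply_of_mem, restrict_apply_of_notMem, hk]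
  · intro k _ hk
    rw [Finsupp.notMem_support_iff.mp hk, mul_zero]

theorem restrict_ind (E : Set ℕ) [DecidablePred (· ∈ E)] (F : Finset ℕ) :
    restrict E (ind F) = ind (F.filter (· ∈ E)) := by
  classical
  rw [ind, restrict_sum, ind, Finset.sum_filter]
  refine Finset.sum_congr rfl fun l _ => ?_
  split_ifs with h
  · exact restrict_eq_self fun k hk => by
      rw [Finset.mem_singleton.mp (Finsupp.support_single_subset hk)]; exact h
  · exact restrict_eq_zero fun k hk => by
      rw [Finset.mem_singleton.mp (Finsupp.support_single_subset hk)]; exact h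

/-! ### Sign flips of functionals along a block sequence -/

/-- The support of `f` lies in the interval spanned by the support of `y`. -/
def InHull (f y : ℕ →₀ ℝ) : Prop :=
  ∃ a ∈ y.support, ∃ b ∈ y.support, ∀ p ∈ f.support, a ≤ p ∧ p ≤ b

theorem exists_lt_or_gt_of_not_inHull {f y : ℕ →₀ ℝ} (hy : y ≠ 0) (h : ¬ InHull f y) :
    (∃ p ∈ f.support, ∀ k ∈ y.support, p < k) ∨ ∃ p ∈ f.support, ∀ k ∈ y.support, k < p := by
  have hne : y.support.Nonempty := Finsupp.support_nonempty_iff.mpr hy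
  by_contra hc
  push Not at hc
  refine h ⟨y.support.min' hne, Finset.min'_mem _ _, y.support.max' hne, Finset.max'_mem _ _, ?_⟩
  intro p hp
  obtain ⟨k, hk, hkp⟩ := hc.1 p hp
  obtain ⟨k', hk', hkp'⟩ := hc.2 p hp
  exact ⟨(Finset.min'_le _ _ hk).trans hkp, hkp'.trans (Finset.le_max' _ _ hk')⟩

/-- Hulls of different blocks are disjoint, so one common support point determines the block. With
`g = x l'` it says that a functional in the hull of `x l` misses every other block. -/
theorem InHull.index_unique {x : ℕ → (ℕ →₀ ℝ)} (hord : ∀ l l', l < l' → Before (x l) (x l'))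
    {f g : ℕ →₀ ℝ} {l l' p : ℕ} (hl : InHull f (x l)) (hl' : InHull g (x l'))
    (hp : p ∈ f.support) (hp' : p ∈ g.support) : l = l' := by
  obtain ⟨a, ha, b, hb, hab⟩ := hl
  obtain ⟨a', ha', b', hb', hab'⟩ := hl'
  have h1 := hab p hp
  have h2 := hab' p hp'
  rcases lt_trichotomy l l' with h | h | h
  · have := hord _ _ h b hb a' ha'
    omega
  · exact h
  · have := hord _ _ h b' hb' a ha
    omega

theorem InHull.refl {y : ℕ →₀ ℝ} (hy : y ≠ 0) : InHull y y := by
  have hne : y.support.Nonempty := Finsupp.support_nonempty_iff.mpr hy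
  exact ⟨y.support.min' hne, Finset.min'_mem _ _, y.support.max' hne, Finset.max'_mem _ _,
    fun p hp => ⟨Finset.min'_le _ _ hp, Finset.le_max' _ _ hp⟩⟩

/-- The functional `g` has the support of `f`, and acts on each interval restriction of `x l` as
`ε l • f` does, up to an error `δ l`. -/
structure IsAlmostFlip (x : ℕ → (ℕ →₀ ℝ)) (ε δ : ℕ → ℝ) (f g : ℕ →₀ ℝ) : Prop where
  support_eq : g.support = f.support
  err_le : ∀ E : Set ℕ, E.OrdConnected → ∀ l,
    |pair (restrict E g) (x l) - ε l * pair (restrict E f) (x l)| ≤ δ l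

/-- An almost flip which is exact on functionals living in the range of a single `x l`. -/
structure IsFlip (x : ℕ → (ℕ →₀ ℝ)) (ε δ : ℕ → ℝ) (f g : ℕ →₀ ℝ) : Prop
    extends IsAlmostFlip x ε δ f g where
  eq_smul : ∀ l, InHull f (x l) → g = ε l • f

theorem pair_restrict_eq_zero {f y : ℕ →₀ ℝ} (h : ∀ k ∈ y.support, k ∉ f.support) (E : Set ℕ) :
    pair (restrict E f) y = 0 :=
  pair_eq_zero fun k hk hk' => h k hk (mem_support_restrict.mp hk').1

section Flip

variable {x : ℕ → (ℕ →₀ ℝ)} {ε δ : ℕ → ℝ}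

/-- If `f` lies in the hull of some `x l`, discard `g` and take `ε l • f`, which is in `S` by
symmetry and vanishes on the other blocks; otherwise exactness is vacuous. This reset makes the
error bound survive the induction. -/
theorem IsAlmostFlip.exists_isFlip (hx : ∀ l, x l ≠ 0)
    (hord : ∀ l l', l < l' → Before (x l) (x l')) (hε : ∀ l, ε l = 1 ∨ ε l = -1)
    (hδ : ∀ l, 0 ≤ δ l) {S : Set (ℕ →₀ ℝ)} (hS : ∀ f ∈ S, -f ∈ S) {f g : ℕ →₀ ℝ}
    (hf : f ∈ S) (hg : g ∈ S) (h : IsAlmostFlip x ε δ f g) : ∃ g ∈ S, IsFlip x ε δ f g := by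
  by_cases hh : ∃ l, InHull f (x l)
  · obtain ⟨l, hl⟩ := hh
    have hne : ε l ≠ 0 := by rcases hε l with h | h <;> rw [h] <;> norm_num
    refine ⟨ε l • f, ?_, ⟨Finsupp.support_smul_eq hne, ?_⟩, ?_⟩
    · rcases hε l with h | h <;> rw [h]
      · rwa [one_smul]
      · rw [neg_one_smul]
        exact hS f hf
    · intro E _ l'
      rw [restrict_smul, pair_smul_left]
      by_cases hll : l = l'
      · subst hll
        rw [sub_self, abs_zero]
        exact hδ l
      · rw [pair_restrict_eq_zero fun k hk hk' =>
          hll (hl.index_unique hord (InHull.refl (hx l')) hk' hk)]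
        simpa using hδ l'
    · intro l' hl'
      by_cases h0 : f = 0
      · rw [h0, smul_zero, smul_zero]
      · obtain ⟨p, hp⟩ := Finsupp.support_nonempty_iff.mpr h0
        rw [hl.index_unique hord hl' hp hp]
  · exact ⟨g, hg, h, fun l hl => (hh ⟨l, hl⟩).elim⟩

theorem IsFlip.err_eq_zero {f g : ℕ →₀ ℝ} (h : IsFlip x ε δ f g) {l : ℕ}
    (hl : (∀ k ∈ (x l).support, k ∉ f.support) ∨ InHull f (x l)) (E : Set ℕ) :
    pair (restrict E g) (x l) - ε l * pair (restrict E f) (x l) = 0 := by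
  rcases hl with hl | hl
  · rw [pair_restrict_eq_zero hl, pair_restrict_eq_zero (by rwa [h.support_eq])]
    simp
  · rw [h.eq_smul l hl, restrict_smul, pair_smul_left, sub_self]

theorem sum_ite_le_of_unique {ι : Type*} (s : Finset ι) {p : ι → Prop} [DecidablePred p] {d : ℝ}
    (hd : 0 ≤ d) (hp : ∀ i ∈ s, ∀ j ∈ s, p i → p j → i = j) :
    ∑ i ∈ s, (if p i then d else 0) ≤ d := by
  rw [← Finset.sum_filter, Finset.sum_const, nsmul_eq_mul]
  refine mul_le_of_le_one_left hd ?_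
  have : (s.filter p).card ≤ 1 := Finset.card_le_one.mpr fun i hi j hj => by
    rw [Finset.mem_filter] at hi hj
    exact hp i hi.1 j hj.1 hi.2 hj.2
  exact_mod_cast this

/-- Of finitely many consecutive functionals, at most two meet `x l` without being contained in
its range. -/
theorem sum_abs_err_le {ι : Type*} [LinearOrder ι] (s : Finset ι) {f g : ι → (ℕ →₀ ℝ)}
    (hx : ∀ l, x l ≠ 0) (hδ : ∀ l, 0 ≤ δ l)
    (hf : ∀ i ∈ s, ∀ j ∈ s, i < j → Before (f i) (f j))
    (hfg : ∀ i ∈ s, IsFlip x ε δ (f i) (g i)) (E : Set ℕ) (hE : E.OrdConnected) (l : ℕ) :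
    ∑ i ∈ s, |pair (restrict E (g i)) (x l) - ε l * pair (restrict E (f i)) (x l)| ≤ 2 * δ l := by
  classical
  -- The only possible sources of error: `p` marks functionals sticking out of `x l` to the left,
  -- `r` to the right. Two successive functionals cannot both do so on the same side while meeting
  -- `x l`.
  let p : ι → Prop := fun i => (∃ k ∈ (x l).support, k ∈ (f i).support) ∧
    ∃ q ∈ (f i).support, ∀ k ∈ (x l).support, q < k
  let r : ι → Prop := fun i => (∃ k ∈ (x l).support, k ∈ (f i).support) ∧
    ∃ q ∈ (f i).support, ∀ k ∈ (x l).support, k < q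
  have hp : ∀ i ∈ s, ∀ j ∈ s, p i → p j → i = j := by
    have key : ∀ i ∈ s, ∀ j ∈ s, p i → p j → ¬ i < j := by
      rintro i hi j hj ⟨⟨k, hk, hk'⟩, -⟩ ⟨-, q, hq, hq'⟩ hij
      exact lt_asymm (hf i hi j hj hij k hk' q hq) (hq' k hk)
    intro i hi j hj h1 h2
    exact le_antisymm (not_lt.mp (key j hj i hi h2 h1)) (not_lt.mp (key i hi j hj h1 h2))
  have hr : ∀ i ∈ s, ∀ j ∈ s, r i → r j → i = j := by
    have key : ∀ i ∈ s, ∀ j ∈ s, r i → r j → ¬ i < j := by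
      rintro i hi j hj ⟨-, q, hq, hq'⟩ ⟨⟨k, hk, hk'⟩, -⟩ hij
      exact lt_asymm (hf i hi j hj hij q hq k hk') (hq' k hk)
    intro i hi j hj h1 h2
    exact le_antisymm (not_lt.mp (key j hj i hi h2 h1)) (not_lt.mp (key i hi j hj h1 h2))
  calc ∑ i ∈ s, |pair (restrict E (g i)) (x l) - ε l * pair (restrict E (f i)) (x l)|
      ≤ ∑ i ∈ s, ((if p i then δ l else 0) + if r i then δ l else 0) := by
        refine Finset.sum_le_sum fun i hi => ?_
        have h0 : ∀ q : Prop, ∀ _ : Decidable q, 0 ≤ if q then δ l else 0 := by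
          intro q _
          split_ifs
          exacts [hδ l, le_rfl]
        by_cases hl : (∀ k ∈ (x l).support, k ∉ (f i).support) ∨ InHull (f i) (x l)
        · rw [(hfg i hi).err_eq_zero hl, abs_zero]
          exact add_nonneg (h0 _ _) (h0 _ _)
        · push Not at hl
          have h1 := (hfg i hi).err_le E hE l
          rcases exists_lt_or_gt_of_not_inHull (hx l) hl.2 with h | h
          · rw [if_pos (show p i from ⟨hl.1, h⟩)]
            linarith [h0 (r i) inferInstance]
          · rw [if_pos (show r i from ⟨hl.1, h⟩)]
            linarith [h0 (p i) inferInstance]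
    _ ≤ δ l + δ l := by
        rw [Finset.sum_add_distrib]
        exact add_le_add (sum_ite_le_of_unique s (hδ l) hp) (sum_ite_le_of_unique s (hδ l) hr)
    _ = 2 * δ l := by ring

end Flip

theorem mem_support_sum_of_disjoint {ι : Type*} (s : Finset ι) {f : ι → (ℕ →₀ ℝ)}
    (hf : ∀ i ∈ s, ∀ j ∈ s, ∀ p, p ∈ (f i).support → p ∈ (f j).support → i = j) (p : ℕ) :
    p ∈ (∑ i ∈ s, f i).support ↔ ∃ i ∈ s, p ∈ (f i).support := by
  rw [Finsupp.mem_support_iff, Finsupp.finsetSum_apply]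
  constructor
  · intro h
    obtain ⟨i, hi, h⟩ := Finset.exists_ne_zero_of_sum_ne_zero h
    exact ⟨i, hi, Finsupp.mem_support_iff.mpr h⟩
  · rintro ⟨i, hi, h⟩
    rw [Finset.sum_eq_single_of_mem i hi]
    · exact Finsupp.mem_support_iff.mp h
    · intro j hj hji
      exact Finsupp.notMem_support_iff.mp fun h' => hji (hf j hj i hi p h' h)

/-- Disjoint supports exclude cancellation, so the support of the sum depends only on those of the
terms. -/
theorem support_sum_congr {ι : Type*} (s : Finset ι) {f g : ι → (ℕ →₀ ℝ)}
    (hfg : ∀ i ∈ s, (g i).support = (f i).support)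
    (hf : ∀ i ∈ s, ∀ j ∈ s, ∀ p, p ∈ (f i).support → p ∈ (f j).support → i = j) :
    (∑ i ∈ s, g i).support = (∑ i ∈ s, f i).support := by
  ext p
  rw [mem_support_sum_of_disjoint s hf, mem_support_sum_of_disjoint s]
  · refine exists_congr fun i => and_congr_right fun hi => ?_
    rw [hfg i hi]
  · intro i hi j hj p
    rw [hfg i hi, hfg j hj]
    exact hf i hi j hj p

/-! ### Growth of the parameters and the flip of even-indexed functionals -/

namespace Params

variable (P : Params)

theorem two_pow_le_m (j : ℕ) (hj : 1 ≤ j) : 2 ^ j ≤ P.m j := by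
  induction j, hj using Nat.le_induction with
  | base => simp [P.m_one]
  | succ j hj ih =>
    have h1 := P.one_le_m j hj
    rw [P.m_succ j hj]
    have h2 : 2 ≤ P.m j := le_trans (by
      calc 2 = 2 ^ 1 := rfl
        _ ≤ 2 ^ j := Nat.pow_le_pow_right (by norm_num) hj) ih
    calc 2 ^ (j + 1) = 2 ^ j * 2 := pow_succ _ _
      _ ≤ P.m j * P.m j := Nat.mul_le_mul ih h2
      _ = P.m j ^ 2 := by ring
      _ ≤ P.m j ^ 5 := Nat.pow_le_pow_right h1 (by norm_num)

theorem four_le_m (j : ℕ) (hj : 2 ≤ j) : 4 ≤ P.m j :=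
  le_trans (by
    calc 4 = 2 ^ 2 := rfl
      _ ≤ 2 ^ j := Nat.pow_le_pow_right (by norm_num) hj) (P.two_pow_le_m j (by omega))

/-- `n_{i+1}` is a power `(4 n_i)^s` with `n_i ≥ 1`, and `2 ^ s ≥ m_{i+1} ^ 3`. -/
theorem cube_m_le_n (j : ℕ) (hj : 2 ≤ j) : P.m j ^ 3 ≤ P.n j := by
  obtain ⟨i, rfl⟩ : ∃ i, j = i + 1 := ⟨j - 1, by omega⟩
  have hn : ∀ i, 1 ≤ i → 1 ≤ P.n i := by
    intro i hi
    induction i, hi using Nat.le_induction with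
    | base => simp [P.n_one]
    | succ i hi ih =>
      obtain ⟨s, hs, -⟩ := P.n_succ i hi
      rw [hs]
      exact Nat.one_le_pow _ _ (by omega)
  obtain ⟨s, hs, h⟩ := P.n_succ i (by omega)
  rw [hs]
  have := hn i (by omega)
  exact h.trans (Nat.pow_le_pow_left (by omega) s)

/-- Flip each summand: at most two of them err on a given `x l`, and `2 / m_j ≤ 1`. Equality of
supports keeps the summands successive. -/
theorem exists_almostFlip_evenStep {x : ℕ → (ℕ →₀ ℝ)} {ε δ : ℕ → ℝ} (hx : ∀ l, x l ≠ 0)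
    (hδ : ∀ l, 0 ≤ δ l) {j : ℕ} (hj : 2 ≤ j) {A : Set (ℕ →₀ ℝ)}
    (hA : ∀ f ∈ A, ∃ g ∈ A, IsFlip x ε δ f g) {f : ℕ →₀ ℝ} (hf : f ∈ P.evenStep j A) :
    ∃ g ∈ P.evenStep j A, IsAlmostFlip x ε δ f g := by
  obtain ⟨L, hlen, hLA, hL, rfl⟩ := hf
  choose! G hGA hG using hA
  have hm : (4 : ℝ) ≤ P.m j := by exact_mod_cast P.four_le_m j hj
  have hbef : ∀ a b : Fin L.length, a < b → Before L[a] L[b] := fun a b hab =>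
    List.pairwise_iff_getElem.mp hL a b a.2 b.2 hab
  have hflip : ∀ a : Fin L.length, IsFlip x ε δ L[a] (G L[a]) := fun a =>
    hG _ (hLA _ (List.getElem_mem a.2))
  have hs1 : L.sum = ∑ a : Fin L.length, L[a] := by
    simp
  have hs2 : (L.map G).sum = ∑ a : Fin L.length, G L[a] := (Fin.sum_univ_fun_getElem L G).symm
  refine ⟨(1 / (P.m j : ℝ)) • (L.map G).sum, ⟨L.map G, by simpa using hlen, ?_, ?_, rfl⟩, ?_, ?_⟩
  · intro g hg
    obtain ⟨g', hg', rfl⟩ := List.mem_map.mp hg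
    exact hGA g' (hLA g' hg')
  · rw [List.pairwise_map]
    refine hL.imp_of_mem fun {a b} ha hb hab => ?_
    intro p hp q hq
    rw [(hG a (hLA a ha)).support_eq] at hp
    rw [(hG b (hLA b hb)).support_eq] at hq
    exact hab p hp q hq
  · have h0 : 1 / (P.m j : ℝ) ≠ 0 := by positivity
    rw [Finsupp.support_smul_eq h0, Finsupp.support_smul_eq h0, hs1, hs2]
    refine support_sum_congr _ (fun a _ => (hflip a).support_eq) ?_
    intro a _ b _ p ha hb
    by_contra hne
    rcases lt_or_gt_of_ne hne with h | h
    · exact lt_irrefl p (hbef a b h p ha p hb)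
    · exact lt_irrefl p (hbef b a h p hb p ha)
  · intro E hE l
    have h1 := sum_abs_err_le Finset.univ hx hδ (fun a _ b _ hab => hbef a b hab)
      (fun a _ => hflip a) E hE l
    rw [hs1, hs2, restrict_smul, restrict_smul, restrict_sum, restrict_sum, pair_smul_left,
      pair_smul_left, pair_sum_left, pair_sum_left]
    have h2 : 1 / (P.m j : ℝ) * ∑ a : Fin L.length, pair (restrict E (G L[a])) (x l) -
        ε l * (1 / (P.m j : ℝ) * ∑ a : Fin L.length, pair (restrict E L[a]) (x l)) =
        1 / (P.m j : ℝ) * ∑ a : Fin L.length,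
          (pair (restrict E (G L[a])) (x l) - ε l * pair (restrict E L[a]) (x l)) := by
      rw [Finset.sum_sub_distrib, ← Finset.mul_sum]
      ring
    rw [h2, abs_mul, abs_of_nonneg (by positivity), one_div_mul_eq_div,
      div_le_iff₀ (by positivity)]
    have h3 := (Finset.abs_sum_le_sum_abs (fun a : Fin L.length =>
      pair (restrict E (G L[a])) (x l) - ε l * pair (restrict E L[a]) (x l)) Finset.univ).trans h1
    nlinarith [hδ l]

end Params

/-! ### Special sequences and the flip of odd-indexed functionals -/

theorem fnl_eq_getElem {φ : List ((ℕ →₀ ℝ) × (ℕ →₀ ℝ))} {a : ℕ} (ha : 1 ≤ a) (ha' : a ≤ φ.length) :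
    ∃ h : a - 1 < φ.length, fnl φ a = (φ[a - 1]).2 := by
  refine ⟨by omega, ?_⟩
  unfold fnl
  rw [List.getD_eq_getElem]

theorem IsQs.isQ_fnl {φ : List ((ℕ →₀ ℝ) × (ℕ →₀ ℝ))} (hφ : IsQs φ) {a : ℕ} (ha : 1 ≤ a)
    (ha' : a ≤ φ.length) : IsQ (fnl φ a) := by
  obtain ⟨h, e⟩ := fnl_eq_getElem ha ha'
  rw [e]
  exact (hφ.2.1 _ (List.getElem_mem h)).2

theorem IsQs.before_fnl {φ : List ((ℕ →₀ ℝ) × (ℕ →₀ ℝ))} (hφ : IsQs φ) {a b : ℕ} (ha : 1 ≤ a)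
    (hab : a < b) (hb : b ≤ φ.length) : Before (fnl φ a) (fnl φ b) := by
  obtain ⟨h, e⟩ := fnl_eq_getElem ha (by omega : a ≤ φ.length)
  obtain ⟨h', e'⟩ := fnl_eq_getElem (by omega : 1 ≤ b) hb
  rw [e, e']
  intro p hp q hq
  exact List.pairwise_iff_getElem.mp hφ.2.2 (a - 1) (b - 1) h h' (by omega) p
    (Finset.mem_union_right _ hp) q (Finset.mem_union_right _ hq)

theorem IsQs.take {φ : List ((ℕ →₀ ℝ) × (ℕ →₀ ℝ))} (hφ : IsQs φ) {a : ℕ} (ha : 1 ≤ a) :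
    IsQs (φ.take a) := by
  refine ⟨?_, fun p hp => hφ.2.1 p (List.mem_of_mem_take hp), hφ.2.2.sublist (List.take_sublist _ _)⟩
  rw [Ne, List.take_eq_nil_iff]
  rintro (h | h)
  · omega
  · exact hφ.1 h

namespace Params

variable (P : Params)

theorem smul_ind_mem_Ktilde {j : ℕ} (hj : 1 ≤ j) {F : Finset ℕ} (hF : F.card ≤ P.n (2 * j)) :
    (1 / (P.m (2 * j) : ℝ)) • ind F ∈ P.Ktilde :=
  Or.inr (Or.inl ⟨j, F, fun _ => 1, hj, hF, fun _ => Or.inl rfl, rfl⟩)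

theorem restrict_smul_ind_mem_Ktilde {j : ℕ} (hj : 1 ≤ j) {F : Finset ℕ}
    (hF : F.card ≤ P.n (2 * j)) (E : Set ℕ) :
    restrict E ((1 / (P.m (2 * j) : ℝ)) • ind F) ∈ P.Ktilde := by
  classical
  rw [restrict_smul, restrict_ind]
  exact P.smul_ind_mem_Ktilde hj ((Finset.card_filter_le _ _).trans hF)

variable {P} in
-- This is where K̃ enters: the unflipped functionals of a special sequence are flat averages of
-- even weight, hence are controlled on `x l` by its K̃-norm.
theorem IsSpecial.restrict_fnl_odd_mem_Ktilde {φ : List ((ℕ →₀ ℝ) × (ℕ →₀ ℝ))} {k : ℕ}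
    (hφ : P.IsSpecial φ k) {i : ℕ} (hi : 1 ≤ i) (hik : i ≤ k) (E : Set ℕ) :
    restrict E (fnl φ (2 * i - 1)) ∈ P.Ktilde := by
  obtain ⟨-, hQ, -, ⟨j, hj, -, F, hF, -, hf⟩, -, hodd⟩ := hφ
  by_cases h1 : i = 1
  · subst h1
    rw [show 2 * 1 - 1 = 1 from rfl, hf]
    exact P.restrict_smul_ind_mem_Ktilde hj hF.le E
  · obtain ⟨F, hF, -, hf⟩ := hodd (i - 1) (by omega) (by omega)
    obtain ⟨j, hj, hσ⟩ := P.σ_even (φ.take (2 * (i - 1))) (hQ.take (by omega))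
    rw [show 2 * (i - 1) + 1 = 2 * i - 1 by omega, hσ] at hf
    rw [hσ] at hF
    rw [hf]
    exact P.restrict_smul_ind_mem_Ktilde hj hF.le E

variable {P} in
/-- Flipping an even-indexed functional of a special sequence together with its coefficient. -/
theorem exists_flip_with_coefficient {x : ℕ → (ℕ →₀ ℝ)} {ε δ : ℕ → ℝ}
    (hord : ∀ l l', l < l' → Before (x l) (x l')) (hε : ∀ l, ε l = 1 ∨ ε l = -1)
    {B : Set (ℕ →₀ ℝ)} (hB : ∀ f ∈ B, ∃ g ∈ B, IsFlip x ε δ f g) {f v : ℕ →₀ ℝ} (hf : f ∈ B)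
    (hf0 : f ≠ 0) {lam m n : ℝ} (hlam : pair f v ≠ 0 → lam = pair f (m • v))
    (hlam0 : pair f v = 0 → lam = n ∨ lam = -n) :
    ∃ g ∈ B, ∃ lam' : ℝ, IsFlip x ε δ f g ∧ (pair g v ≠ 0 → lam' = pair g (m • v)) ∧
      (pair g v = 0 → lam' = n ∨ lam' = -n) ∧ ∀ l, InHull f (x l) → lam' = ε l * lam := by
  obtain ⟨g, hg, hfg⟩ := hB f hf
  by_cases hh : ∃ l, InHull f (x l)
  · obtain ⟨l, hl⟩ := hh
    have hgf := hfg.eq_smul l hl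
    have hne : ε l ≠ 0 := by rcases hε l with h | h <;> rw [h] <;> norm_num
    -- Multiplying by the sign respects both coefficient rules: the first is linear in the
    -- functional, and the default values `±n` are symmetric.
    refine ⟨g, hg, ε l * lam, hfg, ?_, ?_, ?_⟩
    · intro h
      rw [hgf, pair_smul_left] at h ⊢
      rw [hlam (right_ne_zero_of_mul h)]
    · intro h
      rw [hgf, pair_smul_left] at h
      have h0 := (mul_eq_zero.mp h).resolve_left hne
      rcases hε l with e | e <;> rcases hlam0 h0 with h1 | h1 <;> rw [e, h1] <;> simp
    · intro l' hl'
      obtain ⟨p, hp⟩ := Finsupp.support_nonempty_iff.mpr hf0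
      rw [hl.index_unique hord hl' hp hp]
  -- Without a block containing `f`, no relation between the two coefficients is required, so any
  -- value permitted for `g` will do.
  · by_cases h0 : pair g v = 0
    · exact ⟨g, hg, n, hfg, fun h => (h h0).elim, fun _ => Or.inl rfl,
        fun l hl => (hh ⟨l, hl⟩).elim⟩
    · exact ⟨g, hg, pair g (m • v), hfg, fun _ => rfl, fun h => (h0 h).elim,
        fun l hl => (hh ⟨l, hl⟩).elim⟩

theorem abs_coefficient_le_one {g v : ℕ →₀ ℝ} {lam m n : ℝ} (hm : 0 < m) (hn : 0 ≤ n) (hn1 : n ≤ 1)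
    (hg : |pair g v| ≤ 1 / m) (hlam : pair g v ≠ 0 → lam = pair g (m • v))
    (hlam0 : pair g v = 0 → lam = n ∨ lam = -n) : |lam| ≤ 1 := by
  by_cases h : pair g v = 0
  · rcases hlam0 h with e | e <;> rw [e]
    · rwa [abs_of_nonneg hn]
    · rwa [abs_neg, abs_of_nonneg hn]
  · rw [hlam h, pair_smul, abs_mul, abs_of_pos hm, mul_comm]
    exact (le_div_iff₀ hm).mp hg

/-- The default value `±n` instead of `0` matters here: a nonzero coefficient makes the support of
the special functional independent of the choice of the `f'_{2i}`. -/
theorem coefficient_ne_zero {g v : ℕ →₀ ℝ} {lam m n : ℝ} (hm : m ≠ 0) (hn : n ≠ 0)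
    (hlam : pair g v ≠ 0 → lam = pair g (m • v))
    (hlam0 : pair g v = 0 → lam = n ∨ lam = -n) : lam ≠ 0 := by
  by_cases h : pair g v = 0
  · rcases hlam0 h with e | e <;> rw [e]
    · exact hn
    · exact neg_ne_zero.mpr hn
  · rw [hlam h, pair_smul]
    exact mul_ne_zero hm h

/-- The special sequence `φ`, the interval and the outer sign are kept, so the conditions involving
only these carry over; each `f'_{2i}` is replaced by its flip of the same index and support, and its
coefficient is adapted. -/
theorem exists_almostFlip_oddStep {x : ℕ → (ℕ →₀ ℝ)} {ε δ : ℕ → ℝ} (hx : ∀ l, x l ≠ 0)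
    (hord : ∀ l l', l < l' → Before (x l) (x l')) (hε : ∀ l, ε l = 1 ∨ ε l = -1)
    (hδ : ∀ l, 0 ≤ δ l) (hxδ : ∀ l, ∀ f ∈ P.Ktilde, |pair f (x l)| ≤ δ l) {j : ℕ} (hj : 2 ≤ j)
    {B : ℕ → Set (ℕ →₀ ℝ)} (hB : ∀ s, ∀ f ∈ B s, ∃ g ∈ B s, IsFlip x ε δ f g) {f : ℕ →₀ ℝ}
    (hf : f ∈ P.oddStep j B) : ∃ g ∈ P.oddStep j B, IsAlmostFlip x ε δ f g := by
  classical
  obtain ⟨φ, k, hk, hφ, hφB, η, E₀, f', lam, hη, hE₀, hf', rfl⟩ := hf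
  have hQ := hφ.2.1
  have hlen := hφ.2.2.1
  have hm : (4 : ℝ) ≤ P.m j := by exact_mod_cast P.four_le_m j hj
  have hn : (1 : ℝ) ≤ P.n j := by
    have h1 := hφ.1
    have h2 : 1 ≤ P.n j := by omega
    exact_mod_cast h2
  have hn2 : (1 : ℝ) ≤ (P.n j : ℝ) ^ 2 := one_le_pow₀ hn
  have hn0 : 0 < 1 / (P.n j : ℝ) ^ 2 := by positivity
  have hn1 : 1 / (P.n j : ℝ) ^ 2 ≤ 1 := (div_le_one (by positivity)).mpr hn2
  have hmσ : ∀ i, 1 ≤ i → (0 : ℝ) < P.m (P.σ (φ.take (2 * i - 1))) := by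
    intro i hi
    obtain ⟨s, hs, hσ⟩ := P.σ_even _ (hQ.take (by omega : 1 ≤ 2 * i - 1))
    rw [hσ]
    exact_mod_cast P.one_le_m (2 * s) (by omega)
  have hf0 : ∀ i, 1 ≤ i → i ≤ k → f' i ≠ 0 := by
    intro i h1 h2
    rw [← Finsupp.support_nonempty_iff, (hf' i h1 h2).1, Finsupp.support_nonempty_iff]
    exact (hQ.isQ_fnl (by omega) (by omega)).1
  have hex : ∀ i, ∃ g lam', 1 ≤ i → i ≤ k → g ∈ B (P.σ (φ.take (2 * i - 1))) ∧
      IsFlip x ε δ (f' i) g ∧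
      (pair g (vec φ (2 * i)) ≠ 0 →
        lam' = pair g ((P.m (P.σ (φ.take (2 * i - 1))) : ℝ) • vec φ (2 * i))) ∧
      (pair g (vec φ (2 * i)) = 0 → lam' = 1 / (P.n j : ℝ) ^ 2 ∨ lam' = -(1 / (P.n j : ℝ) ^ 2)) ∧
      ∀ l, InHull (f' i) (x l) → lam' = ε l * lam i := by
    intro i
    by_cases hi : 1 ≤ i ∧ i ≤ k
    · obtain ⟨-, h1, -, h2, h3⟩ := hf' i hi.1 hi.2
      obtain ⟨g, hg, lam', h⟩ :=
        exists_flip_with_coefficient hord hε (hB _) h1 (hf0 i hi.1 hi.2) h2 h3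
      exact ⟨g, lam', fun _ _ => ⟨hg, h⟩⟩
    · exact ⟨0, 0, fun h1 h2 => (hi ⟨h1, h2⟩).elim⟩
  choose g lam' hg using hex
  have hlam : ∀ i, 1 ≤ i → i ≤ k → |lam i| ≤ 1 ∧ lam i ≠ 0 := by
    intro i h1 h2
    obtain ⟨-, h3, h4, h5, h6⟩ := hf' i h1 h2
    exact ⟨abs_coefficient_le_one (hmσ i h1) hn0.le hn1 (h4 _ h3) h5 h6,
      coefficient_ne_zero (hmσ i h1).ne' hn0.ne' h5 h6⟩
  have hlam' : ∀ i, 1 ≤ i → i ≤ k → |lam' i| ≤ 1 ∧ lam' i ≠ 0 := by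
    intro i h1 h2
    obtain ⟨-, -, h4, -, -⟩ := hf' i h1 h2
    obtain ⟨h3, -, h5, h6, -⟩ := hg i h1 h2
    exact ⟨abs_coefficient_le_one (hmσ i h1) hn0.le hn1 (h4 _ h3) h5 h6,
      coefficient_ne_zero (hmσ i h1).ne' hn0.ne' h5 h6⟩
  have hbef : ∀ i ∈ Finset.Icc 1 k, ∀ i' ∈ Finset.Icc 1 k, i < i' → Before (f' i) (f' i') := by
    intro i hi i' hi' hii p hp q hq
    rw [Finset.mem_Icc] at hi hi'
    rw [(hf' i hi.1 hi.2).1] at hp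
    rw [(hf' i' hi'.1 hi'.2).1] at hq
    exact hQ.before_fnl (by omega) (by omega : 2 * i < 2 * i') (by omega) p hp q hq
  have hsupp : ∀ (h : ℕ → (ℕ →₀ ℝ)) (c : ℕ → ℝ), ∀ i, 1 ≤ i → i ≤ k → c i ≠ 0 →
      (h i).support = (fnl φ (2 * i)).support →
      (c i • fnl φ (2 * i - 1) + h i).support =
        (fnl φ (2 * i - 1)).support ∪ (fnl φ (2 * i)).support := by
    intro h c i h1 h2 hc hh
    have hs := Finsupp.support_smul_eq hc (g := fnl φ (2 * i - 1))
    rw [Finsupp.support_add_eq, hs, hh]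
    rw [hs, hh, Finset.disjoint_left]
    intro p hp hp'
    exact lt_irrefl p (hQ.before_fnl (by omega) (by omega : 2 * i - 1 < 2 * i) (by omega) p hp p hp')
  have hdisj : ∀ i ∈ Finset.Icc 1 k, ∀ i' ∈ Finset.Icc 1 k, ∀ p,
      p ∈ (lam i • fnl φ (2 * i - 1) + f' i).support →
      p ∈ (lam i' • fnl φ (2 * i' - 1) + f' i').support → i = i' := by
    have key : ∀ i ∈ Finset.Icc 1 k, ∀ i' ∈ Finset.Icc 1 k, ∀ p,
        p ∈ (lam i • fnl φ (2 * i - 1) + f' i).support →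
        p ∈ (lam i' • fnl φ (2 * i' - 1) + f' i').support → ¬ i < i' := by
      intro i hi i' hi' p hp hp' hii
      rw [Finset.mem_Icc] at hi hi'
      rw [hsupp f' lam i hi.1 hi.2 (hlam i hi.1 hi.2).2 (hf' i hi.1 hi.2).1, Finset.mem_union] at hp
      rw [hsupp f' lam i' hi'.1 hi'.2 (hlam i' hi'.1 hi'.2).2 (hf' i' hi'.1 hi'.2).1,
        Finset.mem_union] at hp'
      have hb : ∀ a b, 1 ≤ a → a < b → b ≤ 2 * k → p ∈ (fnl φ a).support →
          p ∈ (fnl φ b).support → False := fun a b h1 h2 h3 h4 h5 =>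
        lt_irrefl p (hQ.before_fnl h1 h2 (by omega) p h4 p h5)
      rcases hp with hp | hp <;> rcases hp' with hp' | hp' <;>
        exact hb _ _ (by omega) (by omega) (by omega) hp hp'
    intro i hi i' hi' p hp hp'
    exact le_antisymm (not_lt.mp (key i' hi' i hi p hp' hp)) (not_lt.mp (key i hi i' hi' p hp hp'))
  have hη1 : |η| = 1 := by rcases hη with e | e <;> simp [e]
  refine ⟨_, ⟨φ, k, hk, hφ, hφB, η, E₀, g, lam', hη, hE₀, ?_, rfl⟩, ?_, ?_⟩
  · intro i h1 h2
    obtain ⟨h3, h4, h5, h6, -⟩ := hg i h1 h2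
    exact ⟨h4.support_eq.trans (hf' i h1 h2).1, h3, (hf' i h1 h2).2.2.1, h5, h6⟩
  · have h0 : η / (P.m j : ℝ) ≠ 0 := by
      refine div_ne_zero ?_ (by positivity)
      rw [← abs_pos, hη1]
      norm_num
    rw [Finsupp.support_smul_eq h0, Finsupp.support_smul_eq h0]
    ext p
    rw [mem_support_restrict, mem_support_restrict, support_sum_congr _ _ hdisj]
    intro i hi
    rw [Finset.mem_Icc] at hi
    rw [hsupp f' lam i hi.1 hi.2 (hlam i hi.1 hi.2).2 (hf' i hi.1 hi.2).1,
      hsupp g lam' i hi.1 hi.2 (hlam' i hi.1 hi.2).2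
        ((hg i hi.1 hi.2).2.1.support_eq.trans (hf' i hi.1 hi.2).1)]
  · intro E hE l
    have hE' : (E ∩ E₀).OrdConnected := hE.inter hE₀
    have h1 := sum_abs_err_le (Finset.Icc 1 k) hx hδ hbef
      (fun i hi => (hg i (Finset.mem_Icc.mp hi).1 (Finset.mem_Icc.mp hi).2).2.1) _ hE' l
    have h2 : ∑ i ∈ Finset.Icc 1 k,
        |(lam' i - ε l * lam i) * pair (restrict (E ∩ E₀) (fnl φ (2 * i - 1))) (x l)| ≤
          2 * δ l := by
      -- The indices whose coefficient may lack the right sign on `x l`. If `f_{2i-1}` and a later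
      -- `f_{2i'-1}` both meet `x l`, then `f'_{2i}` lies between them, hence in the hull; so only
      -- one `i` qualifies.
      let p : ℕ → Prop := fun i => (∃ q ∈ (x l).support, q ∈ (fnl φ (2 * i - 1)).support) ∧
        ¬ InHull (f' i) (x l)
      have hp : ∀ i ∈ Finset.Icc 1 k, ∀ i' ∈ Finset.Icc 1 k, p i → p i' → i = i' := by
        have key : ∀ i ∈ Finset.Icc 1 k, ∀ i' ∈ Finset.Icc 1 k, p i → p i' → ¬ i < i' := by
          rintro i hi i' hi' ⟨⟨q, hq, hq'⟩, hh⟩ ⟨⟨q₁, hq₁, hq₁'⟩, -⟩ hii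
          rw [Finset.mem_Icc] at hi hi'
          refine hh ⟨q, hq, q₁, hq₁, fun r hr => ?_⟩
          rw [(hf' i hi.1 hi.2).1] at hr
          exact ⟨(hQ.before_fnl (by omega) (by omega : 2 * i - 1 < 2 * i) (by omega)
              q hq' r hr).le,
            (hQ.before_fnl (by omega) (by omega : 2 * i < 2 * i' - 1) (by omega)
              r hr q₁ hq₁').le⟩
        intro i hi i' hi' h h'
        exact le_antisymm (not_lt.mp (key i' hi' i hi h' h)) (not_lt.mp (key i hi i' hi' h h'))
      refine le_trans (Finset.sum_le_sum fun i hi => ?_)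
        (sum_ite_le_of_unique (Finset.Icc 1 k) (mul_nonneg two_pos.le (hδ l)) hp)
      rw [Finset.mem_Icc] at hi
      split_ifs with hpi
      · rw [abs_mul]
        refine mul_le_mul ?_ (hxδ l _ (hφ.restrict_fnl_odd_mem_Ktilde hi.1 hi.2 _))
          (abs_nonneg _) two_pos.le
        refine (abs_sub _ _).trans ?_
        have hε1 : |ε l| = 1 := by rcases hε l with e | e <;> simp [e]
        rw [abs_mul, hε1]
        linarith [(hlam i hi.1 hi.2).1, (hlam' i hi.1 hi.2).1]
      · refine (abs_eq_zero.mpr ?_).le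
        rcases not_and_or.mp hpi with h | h
        · push Not at h
          rw [pair_restrict_eq_zero h, mul_zero]
        · rw [(hg i hi.1 hi.2).2.2.2.2 l (not_not.mp h), sub_self, zero_mul]
    rw [restrict_smul, restrict_smul, restrict_restrict, restrict_restrict, restrict_sum,
      restrict_sum, pair_smul_left, pair_smul_left, pair_sum_left, pair_sum_left]
    have h3 : ∀ c d A D : ℝ, c * A - d * (c * D) = c * (A - d * D) := fun c d A D => by ring
    rw [h3, Finset.mul_sum, ← Finset.sum_sub_distrib, abs_mul, abs_div, hη1,
      abs_of_nonneg (by positivity : (0 : ℝ) ≤ P.m j), one_div_mul_eq_div,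
      div_le_iff₀ (by positivity)]
    -- One `2 δ l` comes from the coefficients of the odd-indexed functionals, the other from the
    -- flipped ones; `m_j ≥ 4` absorbs both.
    have h4 : |∑ i ∈ Finset.Icc 1 k,
        (pair (restrict (E ∩ E₀) (lam' i • fnl φ (2 * i - 1) + g i)) (x l) -
          ε l * pair (restrict (E ∩ E₀) (lam i • fnl φ (2 * i - 1) + f' i)) (x l))| ≤
        2 * δ l + 2 * δ l := by
      refine (Finset.abs_sum_le_sum_abs _ _).trans (le_trans ?_ (add_le_add h2 h1))
      rw [← Finset.sum_add_distrib]
      refine Finset.sum_le_sum fun i _ => ?_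
      refine le_trans (le_of_eq ?_) (abs_add_le _ _)
      rw [restrict_add, restrict_add, pair_add_left, pair_add_left, restrict_smul, restrict_smul,
        pair_smul_left, pair_smul_left]
      congr 1
      ring
    nlinarith [hδ l]

/-! ### The flip on the whole norming set -/

/-- The index `j` is preserved along with the level because the odd step demands `f'_{2i}` in a set
of prescribed index. Each step yields an almost flip, which `IsAlmostFlip.exists_isFlip` upgrades
before the next level. -/
theorem exists_flip_level {x : ℕ → (ℕ →₀ ℝ)} {ε δ : ℕ → ℝ} (hx : ∀ l, x l ≠ 0)
    (hord : ∀ l l', l < l' → Before (x l) (x l')) (hε : ∀ l, ε l = 1 ∨ ε l = -1)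
    (hδ : ∀ l, 0 ≤ δ l) (hxδ : ∀ l, ∀ f ∈ P.Ktilde, |pair f (x l)| ≤ δ l) (N : ℕ) :
    ∀ j, ∀ f ∈ P.level N j, ∃ g ∈ P.level N j, IsFlip x ε δ f g := by
  induction N with
  | zero =>
    rintro j f hf
    have hs : ∃ k, ∀ p ∈ f.support, p = k := by
      obtain ⟨-, k, rfl | rfl⟩ := hf
      all_goals exact ⟨k, fun p hp => Finset.mem_singleton.mp (Finsupp.support_single_subset hp)⟩
    obtain ⟨k, hk⟩ := hs
    by_cases h : ∃ l, k ∈ (x l).support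
    · obtain ⟨l, hl⟩ := h
      have hfl : InHull f (x l) := ⟨k, hl, k, hl, fun p hp => by simp [hk p hp]⟩
      have hne : ε l ≠ 0 := by rcases hε l with h | h <;> rw [h] <;> norm_num
      have hmem : ε l • f ∈ P.level 0 j := by
        rcases hε l with h | h <;> rw [h]
        · rwa [one_smul]
        · rw [neg_one_smul]
          exact P.level_neg 0 j f hf
      refine IsAlmostFlip.exists_isFlip hx hord hε hδ (P.level_neg 0 j) hf hmem
        ⟨Finsupp.support_smul_eq hne, fun E _ l' => ?_⟩
      rw [restrict_smul, pair_smul_left]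
      by_cases hll : l = l'
      · subst hll
        rw [sub_self, abs_zero]
        exact hδ l
      · rw [pair_restrict_eq_zero fun q hq hq' =>
          hll (hfl.index_unique hord (InHull.refl (hx l')) hq' hq)]
        simpa using hδ l'
    · refine IsAlmostFlip.exists_isFlip hx hord hε hδ (P.level_neg 0 j) hf hf
        ⟨rfl, fun E _ l => ?_⟩
      rw [pair_restrict_eq_zero fun q hq hq' => h ⟨l, hk q hq' ▸ hq⟩]
      simpa using hδ l
  | succ N ih =>
    intro j f hf
    have key : ∃ g ∈ P.level (N + 1) j, IsAlmostFlip x ε δ f g := by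
      rcases hf with hf | ⟨i, hi, hj, hf⟩ | ⟨i, hi, hj, hf⟩
      · obtain ⟨g, hg, h⟩ := ih j f hf
        exact ⟨g, Or.inl hg, h.toIsAlmostFlip⟩
      · obtain ⟨g, hg, h⟩ := P.exists_almostFlip_evenStep hx hδ (by omega) (fun f hf => by
          obtain ⟨l, hl⟩ := Set.mem_iUnion.mp hf
          obtain ⟨g, hg, h⟩ := ih l f hl
          exact ⟨g, Set.mem_iUnion.mpr ⟨l, hg⟩, h⟩) hf
        exact ⟨g, Or.inr (Or.inl ⟨i, hi, hj, hg⟩), h⟩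
      · obtain ⟨g, hg, h⟩ := P.exists_almostFlip_oddStep hx hord hε hδ hxδ (by omega) ih hf
        exact ⟨g, Or.inr (Or.inr ⟨i, hi, hj, hg⟩), h⟩
    obtain ⟨g, hg, h⟩ := key
    exact IsAlmostFlip.exists_isFlip hx hord hε hδ (P.level_neg (N + 1) j) hf hg h

theorem mem_K_iff {f : ℕ →₀ ℝ} : f ∈ P.K ↔ ∃ N j, f ∈ P.level N j := by
  simp only [K, Set.mem_iUnion]

theorem exists_flip_K {x : ℕ → (ℕ →₀ ℝ)} {ε δ : ℕ → ℝ} (hx : ∀ l, x l ≠ 0)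
    (hord : ∀ l l', l < l' → Before (x l) (x l')) (hε : ∀ l, ε l = 1 ∨ ε l = -1)
    (hδ : ∀ l, 0 ≤ δ l) (hxδ : ∀ l, ∀ f ∈ P.Ktilde, |pair f (x l)| ≤ δ l) {f : ℕ →₀ ℝ}
    (hf : f ∈ P.K) : ∃ g ∈ P.K, ∀ l, |pair g (x l) - ε l * pair f (x l)| ≤ δ l := by
  obtain ⟨N, j, hf⟩ := P.mem_K_iff.mp hf
  obtain ⟨g, hg, h⟩ := P.exists_flip_level hx hord hε hδ hxδ N j f hf
  refine ⟨g, P.mem_K_iff.mpr ⟨N, j, hg⟩, fun l => ?_⟩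
  have := h.err_le Set.univ Set.ordConnected_univ l
  rwa [restrict_eq_self fun _ _ => Set.mem_univ _, restrict_eq_self fun _ _ => Set.mem_univ _]
    at this

end Params

/-! ### Interval restrictions, and K̃ inside K -/

theorem Before.trans {x y z : ℕ →₀ ℝ} (hy : y ≠ 0) (hxy : Before x y) (hyz : Before y z) :
    Before x z := by
  obtain ⟨p, hp⟩ := Finsupp.support_nonempty_iff.mpr hy
  exact fun a ha b hb => (hxy a ha p hp).trans (hyz p hp b hb)

theorem IsBlockSeq.before {x : ℕ → (ℕ →₀ ℝ)} (hx : IsBlockSeq x) {l l' : ℕ} (h : l < l') :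
    Before (x l) (x l') := by
  induction l', h using Nat.le_induction with
  | base => exact hx.2 l
  | succ l' _ ih => exact ih.trans (hx.1 l') (hx.2 l')

theorem restrict_list_sum (E : Set ℕ) (L : List (ℕ →₀ ℝ)) :
    restrict E L.sum = (L.map (restrict E)).sum := by
  induction L with
  | nil => simp [restrict_zero]
  | cons f L ih => rw [List.sum_cons, restrict_add, ih, List.map_cons, List.sum_cons]

theorem list_sum_filter_ne_zero (L : List (ℕ →₀ ℝ)) [DecidablePred fun f : ℕ →₀ ℝ => f ≠ 0] :
    (L.filter (fun f => f ≠ 0)).sum = L.sum := by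
  induction L with
  | nil => simp
  | cons f L ih =>
    by_cases h : f = 0
    · rw [List.filter_cons_of_neg (by simpa using h), ih, List.sum_cons, h, zero_add]
    · rw [List.filter_cons_of_pos (by simpa using h), List.sum_cons, List.sum_cons, ih]

namespace Params

variable (P : Params)

theorem level_mono {N M : ℕ} (h : N ≤ M) (j : ℕ) : P.level N j ⊆ P.level M j := by
  induction M, h using Nat.le_induction with
  | base => exact subset_rfl
  | succ M _ ih => exact fun f hf => Or.inl (ih hf)

/-- Even functionals restrict termwise and odd ones absorb the interval into their own. The
alternative `0` is needed because level `0` contains only signed unit vectors. -/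
theorem restrict_mem_level {E : Set ℕ} (hE : E.OrdConnected) (N : ℕ) : ∀ j, ∀ f ∈ P.level N j,
    restrict E f = 0 ∨ restrict E f ∈ P.level N j := by
  classical
  induction N with
  | zero =>
    intro j f hf
    have hs : ∃ k, ∀ p ∈ f.support, p = k := by
      obtain ⟨-, k, rfl | rfl⟩ := hf
      all_goals exact ⟨k, fun p hp => Finset.mem_singleton.mp (Finsupp.support_single_subset hp)⟩
    obtain ⟨k, hk⟩ := hs
    by_cases hkE : k ∈ E
    · rw [restrict_eq_self fun p hp => by rwa [hk p hp]]
      exact Or.inr hf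
    · exact Or.inl (restrict_eq_zero fun p hp => by rwa [hk p hp])
  | succ N ih =>
    rintro j f (hf | ⟨i, hi, hj, L, hlen, hLA, hL, rfl⟩ |
      ⟨i, hi, hj, φ, k, hk, hφ, hB, ε, E₀, f', lam, hε, hE₀, hf', rfl⟩)
    · exact (ih j f hf).imp_right Or.inl
    -- Summands that restrict to zero are dropped, as zero need not belong to the previous level.
    · refine Or.inr (Or.inr (Or.inl ⟨i, hi, hj, (L.map (restrict E)).filter (fun f => f ≠ 0),
        (List.length_filter_le _ _).trans (by simpa using hlen), ?_, ?_, ?_⟩))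
      · intro g hg
        obtain ⟨hg, hg0⟩ := List.mem_filter.mp hg
        obtain ⟨g', hg', rfl⟩ := List.mem_map.mp hg
        obtain ⟨l, hl⟩ := Set.mem_iUnion.mp (hLA g' hg')
        exact Set.mem_iUnion.mpr ⟨l, (ih l g' hl).resolve_left (by simpa using hg0)⟩
      · refine List.Pairwise.filter _ ?_
        rw [List.pairwise_map]
        exact hL.imp fun h p hp q hq =>
          h p (mem_support_restrict.mp hp).1 q (mem_support_restrict.mp hq).1
      · rw [restrict_smul, list_sum_filter_ne_zero, restrict_list_sum]
    · refine Or.inr (Or.inr (Or.inr ⟨i, hi, hj, φ, k, hk, hφ, hB, ε, E ∩ E₀, f', lam, hε,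
        hE.inter hE₀, hf', ?_⟩))
      rw [restrict_smul, restrict_restrict]

theorem exists_common_level (L : List (ℕ →₀ ℝ)) (hL : ∀ g ∈ L, g ∈ P.K) :
    ∃ N, ∀ g ∈ L, ∃ j, g ∈ P.level N j := by
  induction L with
  | nil => exact ⟨0, fun g hg => by simp at hg⟩
  | cons f L ih =>
    obtain ⟨N, hN⟩ := ih fun g hg => hL g (List.mem_cons_of_mem _ hg)
    obtain ⟨M, j, hM⟩ := P.mem_K_iff.mp (hL f List.mem_cons_self)
    refine ⟨max N M, fun g hg => ?_⟩
    rcases List.mem_cons.mp hg with rfl | hg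
    · exact ⟨j, P.level_mono (le_max_right _ _) j hM⟩
    · obtain ⟨i, hi⟩ := hN g hg
      exact ⟨i, P.level_mono (le_max_left _ _) i hi⟩

/-- A finite list from `K` lies in a single level, since levels increase. -/
theorem evenStep_K_subset {i : ℕ} (hi : 1 ≤ i) {f : ℕ →₀ ℝ} (hf : f ∈ P.evenStep (2 * i) P.K) :
    f ∈ P.K := by
  obtain ⟨L, hlen, hLK, hL, rfl⟩ := hf
  obtain ⟨N, hN⟩ := P.exists_common_level L hLK
  exact P.mem_K_iff.mpr ⟨N + 1, 2 * i, Or.inr (Or.inl ⟨i, hi, rfl, L, hlen,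
    fun g hg => Set.mem_iUnion.mpr (hN g hg), hL, rfl⟩)⟩

theorem zero_mem_K : 0 ∈ P.K :=
  P.evenStep_K_subset le_rfl ⟨[], by simp, by simp, by simp, by simp⟩

theorem restrict_mem_K {E : Set ℕ} (hE : E.OrdConnected) {f : ℕ →₀ ℝ} (hf : f ∈ P.K) :
    restrict E f ∈ P.K := by
  obtain ⟨N, j, hf⟩ := P.mem_K_iff.mp hf
  rcases P.restrict_mem_level hE N j f hf with h | h
  · rw [h]
    exact P.zero_mem_K
  · exact P.mem_K_iff.mpr ⟨N, j, h⟩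

theorem normK_restrict_le {E : Set ℕ} (hE : E.OrdConnected) (x : ℕ →₀ ℝ) :
    P.normK (restrict E x) ≤ P.normK x :=
  P.normK_le fun f hf => by
    rw [← pair_restrict]
    exact P.pair_le_normK (P.restrict_mem_K hE hf) x

theorem Ktilde_subset_K : P.Ktilde ⊆ P.K := by
  rintro f (⟨k, h⟩ | ⟨j, F, ε, hj, hF, hε, rfl⟩ | rfl)
  · rcases h with rfl | rfl
    · exact P.single_mem_K k 1 (Or.inl rfl)
    · exact P.single_mem_K k (-1) (Or.inr rfl)
  · refine P.evenStep_K_subset hj ⟨(F.sort (· ≤ ·)).map (fun i => Finsupp.single i (ε i)),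
      by simpa using hF, ?_, ?_, ?_⟩
    · intro g hg
      obtain ⟨i, -, rfl⟩ := List.mem_map.mp hg
      exact P.single_mem_K i _ (hε i)
    · rw [List.pairwise_map]
      refine (Finset.sortedLT_sort F).pairwise.imp fun {a b} hab p hp q hq => ?_
      rw [Finset.mem_singleton.mp (Finsupp.support_single_subset hp),
        Finset.mem_singleton.mp (Finsupp.support_single_subset hq)]
      exact hab
    · congr 1
      rw [Finset.sum_eq_multiset_sum, ← Finset.sort_eq F (· ≤ ·), Multiset.map_coe,
        Multiset.sum_coe]
  · exact P.zero_mem_K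

theorem Ktilde_neg {f : ℕ →₀ ℝ} (hf : f ∈ P.Ktilde) : -f ∈ P.Ktilde := by
  rcases hf with ⟨k, h⟩ | ⟨j, F, ε, hj, hF, hε, rfl⟩ | rfl
  · refine Or.inl ⟨k, ?_⟩
    rcases h with rfl | rfl
    · exact Or.inr (by rw [Finsupp.single_neg])
    · exact Or.inl (by rw [Finsupp.single_neg, neg_neg])
  · refine Or.inr (Or.inl ⟨j, F, fun i => -ε i, hj, hF, fun i => ?_, ?_⟩)
    · rcases hε i with h | h <;> simp [h]
    · simp only [Finsupp.single_neg, Finset.sum_neg_distrib, smul_neg]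
  · exact Or.inr (Or.inr neg_zero)

theorem abs_pair_le_normKtilde {f : ℕ →₀ ℝ} (hf : f ∈ P.Ktilde) (x : ℕ →₀ ℝ) :
    |pair f x| ≤ P.normKtilde x := by
  have hb : BddAbove ((fun f => pair f x) '' P.Ktilde) :=
    (P.bddAbove_K x).mono (Set.image_mono P.Ktilde_subset_K)
  refine abs_le'.mpr ⟨le_csSup hb ⟨f, hf, rfl⟩, ?_⟩
  rw [← pair_neg_left]
  exact le_csSup hb ⟨-f, P.Ktilde_neg hf, rfl⟩

theorem normKtilde_nonneg (x : ℕ →₀ ℝ) : 0 ≤ P.normKtilde x :=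
  (abs_nonneg _).trans (P.abs_pair_le_normKtilde (Or.inr (Or.inr rfl)) x)

theorem normKtilde_le {x : ℕ →₀ ℝ} {c : ℝ} (h : ∀ f ∈ P.Ktilde, pair f x ≤ c) :
    P.normKtilde x ≤ c := by
  refine csSup_le ⟨_, _, Or.inr (Or.inr rfl), rfl⟩ ?_
  rintro _ ⟨f, hf, rfl⟩
  exact h f hf

theorem normK_smul (c : ℝ) (x : ℕ →₀ ℝ) : P.normK (c • x) = |c| * P.normK x :=
  P.core.norm_smul c x

/-! ### Unconditionality from small K̃-norms: part (1) -/

/-- The range of each vector of a block sequence is an interval disjoint from the others. -/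
theorem exists_interval_of_block {x : ℕ → (ℕ →₀ ℝ)} (hx : IsBlockSeq x) (l : ℕ) :
    ∃ E : Set ℕ, E.OrdConnected ∧ restrict E (x l) = x l ∧
      ∀ l', l' ≠ l → restrict E (x l') = 0 := by
  obtain ⟨a, ha, b, hb, hab⟩ := InHull.refl (hx.1 l)
  refine ⟨Set.Icc a b, Set.ordConnected_Icc, restrict_eq_self hab, fun l' hl' => ?_⟩
  refine restrict_eq_zero fun k hk hk' => ?_
  have hk1 : a ≤ k := hk'.1
  have hk2 : k ≤ b := hk'.2
  rcases lt_or_gt_of_ne hl' with h | h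
  · have := hx.before h k hk a ha
    omega
  · have := hx.before h b hb k hk
    omega

theorem abs_coef_le_normK_sum {x : ℕ → (ℕ →₀ ℝ)} (hx : IsBlockSeq x) (h1 : ∀ l, P.normK (x l) = 1)
    (s : Finset ℕ) (a : ℕ → ℝ) {l : ℕ} (hl : l ∈ s) : |a l| ≤ P.normK (∑ i ∈ s, a i • x i) := by
  obtain ⟨E, hE, h2, h3⟩ := exists_interval_of_block hx l
  have h := P.normK_restrict_le hE (∑ i ∈ s, a i • x i)
  rw [restrict_sum, Finset.sum_eq_single_of_mem l hl, restrict_smul, h2, normK_smul, h1,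
    mul_one] at h
  · exact h
  · intro i _ hi
    rw [restrict_smul, h3 i hi, smul_zero]

/-- A normalized block sequence with summable `K̃`-norms is unconditional. -/
theorem normK_sum_subset_le {x : ℕ → (ℕ →₀ ℝ)} (hx : IsBlockSeq x) (h1 : ∀ l, P.normK (x l) = 1)
    (hsum : Summable fun l => P.normKtilde (x l)) (s A : Finset ℕ) (hA : A ⊆ s) (a : ℕ → ℝ) :
    P.normK (∑ i ∈ A, a i • x i) ≤
      (1 + ∑' l, P.normKtilde (x l)) * P.normK (∑ i ∈ s, a i • x i) := by
  classical
  set T := ∑' l, P.normKtilde (x l)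
  set R := P.normK (∑ i ∈ s, a i • x i)
  have hT : 0 ≤ T := tsum_nonneg fun l => P.normKtilde_nonneg _
  have hR : 0 ≤ R := P.normK_nonneg _
  refine P.normK_le fun f hf => ?_
  -- With this choice `(1 + ε) / 2` is the indicator of `A`, so the projection is the average of the
  -- identity and a change of signs.
  let ε : ℕ → ℝ := fun i => if i ∈ A then 1 else -1
  have hε : ∀ l, ε l = 1 ∨ ε l = -1 := fun l => by
    by_cases h : l ∈ A <;> simp [ε, h]
  obtain ⟨g, hg, hfg⟩ := P.exists_flip_K hx.1 (fun l l' h => hx.before h) hε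
    (fun l => P.normKtilde_nonneg (x l)) (fun l f hf => P.abs_pair_le_normKtilde hf (x l)) hf
  have e1 : pair f (∑ i ∈ A, a i • x i) = ∑ i ∈ s, 1 / 2 * (1 + ε i) * (a i * pair f (x i)) := by
    rw [pair_sum, ← Finset.sum_subset hA]
    · refine Finset.sum_congr rfl fun i hi => ?_
      simp only [ε, if_pos hi, pair_smul]
      ring
    · intro i _ hi
      simp [ε, hi]
  have e2 : ∀ i ∈ s, 1 / 2 * (1 + ε i) * (a i * pair f (x i)) ≤
      1 / 2 * (a i * pair f (x i)) + 1 / 2 * (a i * pair g (x i)) +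
        1 / 2 * (R * P.normKtilde (x i)) := by
    intro i hi
    have h2 : a i * (ε i * pair f (x i) - pair g (x i)) ≤ R * P.normKtilde (x i) := by
      refine (le_abs_self _).trans ?_
      rw [abs_mul]
      refine mul_le_mul (P.abs_coef_le_normK_sum hx h1 s a hi) ?_ (abs_nonneg _) hR
      rw [abs_sub_comm]
      exact hfg i
    linarith
  rw [e1]
  refine (Finset.sum_le_sum e2).trans ?_
  rw [Finset.sum_add_distrib, Finset.sum_add_distrib, ← Finset.mul_sum, ← Finset.mul_sum,
    ← Finset.mul_sum, ← Finset.mul_sum]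
  have e3 : ∀ f ∈ P.K, ∑ i ∈ s, a i * pair f (x i) ≤ R := fun f hf => by
    have := P.pair_le_normK hf (∑ i ∈ s, a i • x i)
    rw [pair_sum] at this
    simpa only [pair_smul] using this
  have e4 : R * ∑ i ∈ s, P.normKtilde (x i) ≤ R * T :=
    mul_le_mul_of_nonneg_left (hsum.sum_le_tsum s fun i _ => P.normKtilde_nonneg _) hR
  -- The two averaged terms give `R`, and the flip errors at most `R * T / 2`.
  nlinarith [e3 f hf, e3 g hg, mul_nonneg hR hT]

/-- The canonical inclusion of `c₀₀` in `X_ius` as a linear map. -/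
noncomputable def toXₗ : (ℕ →₀ ℝ) →ₗ[ℝ] P.X :=
  (UniformSpace.Completion.toComplₗᵢ : P.C00 →ₗᵢ[ℝ] P.X).toLinearMap

theorem toXₗ_apply (x : ℕ →₀ ℝ) : P.toXₗ x = P.toX x := rfl

theorem toX_sum_smul (s : Finset ℕ) (a : ℕ → ℝ) (x : ℕ → (ℕ →₀ ℝ)) :
    P.toX (∑ i ∈ s, a i • x i) = ∑ i ∈ s, a i • P.toX (x i) := by
  simp only [← toXₗ_apply, map_sum, map_smul]

theorem isUnconditionalBasicSeq_of_perturbation {x : ℕ → (ℕ →₀ ℝ)} (hx : IsBlockSeq x)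
    (h1 : ∀ l, P.normK (x l) = 1) (hsum : Summable fun l => P.normKtilde (x l)) {y : ℕ → P.X}
    {τ : ℕ → ℝ} (hτ : ∀ i, ‖P.toX (x i) - y i‖ ≤ τ i)
    (hτs : ∀ s : Finset ℕ, ∑ i ∈ s, τ i ≤ 1 / 2) : IsUnconditionalBasicSeq y := by
  have hT : 0 ≤ ∑' l, P.normKtilde (x l) := tsum_nonneg fun l => P.normKtilde_nonneg _
  refine IsUnconditionalBasicSeq.of_bound (fun n hn => ?_) (projection_bound_of_perturbation
    (C := 1 + ∑' l, P.normKtilde (x l)) (by linarith) ?_ ?_ hτ hτs)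
  · have h2 := hτ n
    have h3 := hτs {n}
    rw [hn, sub_zero, norm_toX, h1] at h2
    rw [Finset.sum_singleton] at h3
    linarith
  · intro s A hA a
    rw [← toX_sum_smul, ← toX_sum_smul, norm_toX, norm_toX]
    exact P.normK_sum_subset_le hx h1 hsum s A hA a
  · intro s a i hi
    rw [← toX_sum_smul, norm_toX]
    exact P.abs_coef_le_normK_sum hx h1 s a hi

theorem exists_unconditional_subsequence {x : ℕ → (ℕ →₀ ℝ)} (hx : IsBlockSeq x)
    (h1 : ∀ l, P.normK (x l) = 1)
    (h0 : Filter.Tendsto (fun l => P.normKtilde (x l)) Filter.atTop (nhds 0)) :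
    ∃ M : ℕ → ℕ, StrictMono M ∧ IsUnconditionalBasicSeq (fun i => P.toX (x (M i))) := by
  -- A subsequence with geometrically decreasing K̃-norms; no perturbation is needed, so `τ = 0`
  -- below.
  obtain ⟨M, hM, hM'⟩ := Filter.extraction_forall_of_eventually
    (P := fun i k => P.normKtilde (x k) ≤ (1 / 2 : ℝ) ^ i)
    fun i => h0.eventually_le_const (by positivity)
  refine ⟨M, hM, P.isUnconditionalBasicSeq_of_perturbation (x := fun i => x (M i)) (τ := fun _ => 0)
    ⟨fun l => hx.1 _, fun l => hx.before (hM (Nat.lt_succ_self l))⟩ (fun l => h1 _) ?_ ?_ ?_⟩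
  · exact Summable.of_nonneg_of_le (fun i => P.normKtilde_nonneg _) hM' summable_geometric_two
  · intro i
    simp
  · intro s
    simp

end Params

/-! ### Blocks near a subspace, and averaging -/

theorem exists_seq_of_step {α : Type*} (a : α) {T : ℕ → α → α → Prop}
    (h : ∀ i a, ∃ b, T i a b) : ∃ s : ℕ → α, T 0 a (s 0) ∧ ∀ i, T (i + 1) (s i) (s (i + 1)) := by
  choose F hF using h
  exact ⟨fun n => Nat.rec (F 0 a) (fun i b => F (i + 1) b) n, hF 0 a, fun i => hF (i + 1) _⟩

theorem exists_support_bound (u : ℕ →₀ ℝ) : ∃ N, ∀ k ∈ u.support, k < N :=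
  ⟨u.support.sup id + 1, fun _ hk => Nat.lt_succ_of_le (Finset.le_sup (f := id) hk)⟩

namespace Params

variable (P : Params)

theorem abs_apply_le_normK (x : ℕ →₀ ℝ) (k : ℕ) : |x k| ≤ P.normK x := by
  have h := P.abs_pair_le_normK (P.single_mem_K k 1 (Or.inl rfl)) x
  rwa [pair_single, one_mul] at h

theorem ne_zero_of_normK_eq_one {x : ℕ →₀ ℝ} (h : P.normK x = 1) : x ≠ 0 := by
  rintro rfl
  have := P.normK_smul 0 0
  rw [smul_zero, h] at this
  simp at this

theorem exists_le_m (R : ℝ) : ∃ j, 1 ≤ j ∧ ∀ p, j ≤ p → R ≤ P.m (2 * p) := by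
  obtain ⟨j, hj⟩ := exists_nat_ge R
  refine ⟨j + 1, by omega, fun p hp => hj.trans ?_⟩
  have h1 : j ≤ P.m (2 * p) := by
    have h2 := P.two_pow_le_m (2 * p) (by omega)
    have h3 : 2 * p < 2 ^ (2 * p) := Nat.lt_two_pow_self
    omega
  exact_mod_cast h1

/-- The unit functionals belong to `K`, so coordinates are contractive on `c₀₀` and extend to the
completion. -/
theorem exists_coordinate (k : ℕ) : ∃ φ : P.X →L[ℝ] ℝ, (∀ v, |φ v| ≤ ‖v‖) ∧
    ∀ x : ℕ →₀ ℝ, φ (P.toX x) = x k := by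
  have hd : DenseRange P.toXₗ :=
    UniformSpace.Completion.denseRange_coe (α := P.C00)
  have hb : ∀ x : ℕ →₀ ℝ, ‖(Finsupp.lapply k : (ℕ →₀ ℝ) →ₗ[ℝ] ℝ) x‖ ≤ 1 * ‖P.toXₗ x‖ := by
    intro x
    rw [one_mul, toXₗ_apply, norm_toX]
    exact P.abs_apply_le_normK x k
  refine ⟨(Finsupp.lapply k : (ℕ →₀ ℝ) →ₗ[ℝ] ℝ).extendOfNorm P.toXₗ, fun v => ?_, fun x => ?_⟩
  · have := LinearMap.norm_extendOfNorm_apply_le hd 1 hb v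
    rwa [one_mul] at this
  · exact LinearMap.extendOfNorm_eq hd ⟨1, hb⟩ x

/-- `x` is a normalized vector supported on `[N, ∞)` at distance at most `η` from `Y`. -/
def NearSubspace (Y : Submodule ℝ P.X) (N : ℕ) (η : ℝ) (x : ℕ →₀ ℝ) : Prop :=
  (∀ k ∈ x.support, N ≤ k) ∧ P.normK x = 1 ∧ ∃ y ∈ Y, ‖P.toX x - y‖ ≤ η

variable {P}

theorem nearSubspace_of_le {Y : Submodule ℝ P.X} {N : ℕ} {η : ℝ} {x : ℕ →₀ ℝ} {y : P.X}
    (hy : y ∈ Y) (hx : ∀ k ∈ x.support, N ≤ k) (hpos : 0 < P.normK x)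
    (hxy : ‖P.toX x - y‖ ≤ η * P.normK x) : P.NearSubspace Y N η ((P.normK x)⁻¹ • x) := by
  refine ⟨fun k hk => hx k (Finsupp.support_smul hk), ?_, (P.normK x)⁻¹ • y,
    Y.smul_mem _ hy, ?_⟩
  · rw [normK_smul, abs_inv, abs_of_pos hpos, inv_mul_cancel₀ hpos.ne']
  · rw [← toXₗ_apply, map_smul, toXₗ_apply, ← smul_sub, norm_smul, norm_inv,
      Real.norm_of_nonneg hpos.le, inv_mul_le_iff₀ hpos, mul_comm]
    exact hxy

/-- Finitely many coordinate functionals have a common zero of norm one in `Y`. Approximate it in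
`c₀₀`, delete the first `N` coordinates, which are small, and normalize. -/
theorem exists_nearSubspace {Y : Submodule ℝ P.X} (hY : ¬ FiniteDimensional ℝ Y) (N : ℕ) {η : ℝ}
    (hη : 0 < η) : ∃ x, P.NearSubspace Y N η x := by
  choose φ hφ hφx using P.exists_coordinate
  obtain ⟨v, hvY, hv, hv0⟩ : ∃ v ∈ Y, ‖v‖ = 1 ∧ ∀ k < N, φ k v = 0 := by
    let Φ : Y →ₗ[ℝ] (Fin N → ℝ) := LinearMap.pi fun k => (φ k : P.X →ₗ[ℝ] ℝ) ∘ₗ Y.subtype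
    have hinj : ¬ Function.Injective Φ := fun h => hY (FiniteDimensional.of_injective Φ h)
    rw [← LinearMap.ker_eq_bot, Submodule.eq_bot_iff] at hinj
    push Not at hinj
    obtain ⟨v, hv, hv0⟩ := hinj
    have hne : ‖(v : P.X)‖ ≠ 0 := by simpa using hv0
    refine ⟨(‖(v : P.X)‖)⁻¹ • (v : P.X), Y.smul_mem _ v.2, ?_, fun k hk => ?_⟩
    · rw [norm_smul, norm_inv, norm_norm, inv_mul_cancel₀ hne]
    · have : φ k v = 0 := congrFun (LinearMap.mem_ker.mp hv) ⟨k, hk⟩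
      rw [map_smul, this, smul_zero]
  -- The bound `1 / 2` keeps the truncated vector of norm at least `1 / 2`, and normalizing then
  -- costs a factor at most `2`. Below, `θ / (N + 1)` is spent once on approximation and once on
  -- each of the `N` deleted coordinates.
  obtain ⟨θ, hθ0, hθ1, hθη⟩ : ∃ θ : ℝ, 0 < θ ∧ θ ≤ 1 / 2 ∧ 2 * θ ≤ η :=
    ⟨min (1 / 2) (η / 2), by positivity, min_le_left _ _, by
      linarith [min_le_right (1 / 2) (η / 2)]⟩
  obtain ⟨w, hw⟩ := Metric.denseRange_iff.mp
    (UniformSpace.Completion.denseRange_coe (α := P.C00)) v (θ / (N + 1)) (by positivity)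
  change ℕ →₀ ℝ at w
  replace hw : ‖v - P.toX w‖ < θ / (N + 1) := by
    rw [dist_eq_norm] at hw
    exact hw
  have hwk : ∀ k ∈ Finset.range N, ‖w k • P.toX (Finsupp.single k 1)‖ ≤ θ / (N + 1) := by
    intro k hk
    have h1 : |w k| ≤ θ / (N + 1) := by
      have h2 := hφ k (v - P.toX w)
      rw [map_sub, hφx, hv0 k (Finset.mem_range.mp hk), zero_sub, abs_neg] at h2
      exact h2.trans hw.le
    have h3 : ‖P.toX (Finsupp.single k 1)‖ ≤ 1 := by
      rw [norm_toX]
      refine P.normK_le fun f hf => (le_abs_self _).trans ?_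
      refine le_trans (le_of_eq ?_) (P.abs_K_le hf k)
      simp [pair_eq_sum, Finsupp.support_single]
    rw [norm_smul, Real.norm_eq_abs]
    exact (mul_le_of_le_one_right (abs_nonneg _) h3).trans h1
  set x := w - ∑ k ∈ Finset.range N, w k • Finsupp.single k (1 : ℝ) with hx
  have hxs : ∀ k ∈ x.support, N ≤ k := by
    intro k hk
    by_contra hkN
    refine Finsupp.mem_support_iff.mp hk ?_
    rw [hx, Finsupp.sub_apply, Finsupp.finsetSum_apply,
      Finset.sum_eq_single_of_mem k (Finset.mem_range.mpr (not_le.mp hkN))]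
    · simp
    · intro i _ hi
      simp [Ne.symm hi]
  have hxv : ‖P.toX x - v‖ ≤ θ := by
    have e : P.toX x - v =
        -(v - P.toX w) - ∑ k ∈ Finset.range N, w k • P.toX (Finsupp.single k 1) := by
      rw [← toX_sum_smul, hx]
      simp only [← toXₗ_apply, map_sub]
      abel
    rw [e]
    refine (norm_sub_le _ _).trans ?_
    rw [norm_neg]
    have h1 := (norm_sum_le _ _).trans (Finset.sum_le_card_nsmul _ _ _ hwk)
    rw [Finset.card_range, nsmul_eq_mul] at h1
    have h2 : θ / (N + 1) + N * (θ / (N + 1)) = θ := by field_simp; ring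
    linarith
  have hnx : 1 / 2 ≤ P.normK x := by
    rw [← norm_toX]
    have := norm_le_norm_add_norm_sub (P.toX x) v
    linarith
  refine ⟨_, nearSubspace_of_le hvY hxs (by linarith) (hxv.trans ?_)⟩
  nlinarith

/-- Functionals nearly norming the blocks, cut to their hulls, are successive, so their sum divided
by `m_{2j}` lies in `K`. -/
theorem half_le_normK_sum {z : ℕ → (ℕ →₀ ℝ)} (hz : IsBlockSeq z) (h1 : ∀ l, P.normK (z l) = 1)
    {j : ℕ} (hj : 1 ≤ j) : (P.n (2 * j) : ℝ) / (2 * P.m (2 * j)) ≤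
      P.normK (∑ i ∈ Finset.range (P.n (2 * j)), z i) := by
  have hm : (0 : ℝ) < P.m (2 * j) := by exact_mod_cast P.one_le_m (2 * j) (by omega)
  have hg : ∀ i, ∃ g ∈ P.K, 1 / 2 ≤ pair g (z i) ∧ InHull g (z i) := by
    intro i
    obtain ⟨a, ha, b, hb, hab⟩ := InHull.refl (hz.1 i)
    have hlt : 1 / 2 < P.normK (z i) := by rw [h1]; norm_num
    obtain ⟨_, ⟨f, hf, rfl⟩, hlt⟩ := exists_lt_of_lt_csSup
      (Set.Nonempty.image _ ⟨_, P.single_mem_K 0 1 (Or.inl rfl)⟩) hlt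
    refine ⟨restrict (Set.Icc a b) f, P.restrict_mem_K Set.ordConnected_Icc hf, ?_, a, ha, b, hb,
      fun p hp => (mem_support_restrict.mp hp).2⟩
    rw [pair_restrict, restrict_eq_self (E := Set.Icc a b) hab]
    exact hlt.le
  choose g hgK hgz hgh using hg
  have hord : ∀ l l', l < l' → Before (z l) (z l') := fun l l' h => hz.before h
  have hbef : ∀ i i', i < i' → Before (g i) (g i') := by
    intro i i' hii p hp q hq
    obtain ⟨a, ha, b, hb, hab⟩ := hgh i
    obtain ⟨a', ha', b', hb', hab'⟩ := hgh i'
    exact ((hab p hp).2.trans_lt (hord i i' hii b hb a' ha')).trans_le (hab' q hq).1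
  have hmem : (1 / (P.m (2 * j) : ℝ)) • ∑ i ∈ Finset.range (P.n (2 * j)), g i ∈ P.K := by
    refine P.evenStep_K_subset hj ⟨(List.range (P.n (2 * j))).map g, by simp, ?_, ?_, rfl⟩
    · intro f hf
      obtain ⟨i, -, rfl⟩ := List.mem_map.mp hf
      exact hgK i
    · rw [List.pairwise_map]
      exact List.pairwise_lt_range.imp fun h => hbef _ _ h
  refine le_trans ?_ (P.pair_le_normK hmem _)
  rw [pair_smul_left, pair_sum_left]
  have h2 : ∀ i ∈ Finset.range (P.n (2 * j)),
      1 / 2 ≤ pair (g i) (∑ l ∈ Finset.range (P.n (2 * j)), z l) := by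
    intro i hi
    rw [pair_sum, Finset.sum_eq_single_of_mem i hi]
    · exact hgz i
    · intro l _ hli
      exact pair_eq_zero fun k hk hk' =>
        hli ((hgh i).index_unique hord (InHull.refl (hz.1 l)) hk' hk).symm
  have h3 := Finset.card_nsmul_le_sum _ _ _ h2
  rw [Finset.card_range, nsmul_eq_mul] at h3
  calc (P.n (2 * j) : ℝ) / (2 * P.m (2 * j)) = 1 / (P.m (2 * j) : ℝ) * (P.n (2 * j) * (1 / 2)) := by
        field_simp
    _ ≤ _ := by gcongr

/-- Normalized sums of `n_{2j}` consecutive vectors near `Y` are near `Y`, with a small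
normalizing factor. -/
theorem exists_nearSubspace_smul_sum {Y : Submodule ℝ P.X} {N : ℕ} {η : ℝ} (hη : 0 ≤ η)
    {z : ℕ → (ℕ →₀ ℝ)} (hz : IsBlockSeq z) {j : ℕ} (hj : 1 ≤ j)
    (h : ∀ i, P.NearSubspace Y N (η / P.n (2 * j)) (z i)) :
    ∃ c : ℝ, 0 < c ∧ c ≤ 2 / P.m (2 * j) ∧
      P.NearSubspace Y N η (c • ∑ i ∈ Finset.range (P.n (2 * j)), z i) := by
  have hm : (4 : ℝ) ≤ P.m (2 * j) := by exact_mod_cast P.four_le_m (2 * j) (by omega)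
  have hn : (P.m (2 * j) : ℝ) ^ 3 ≤ P.n (2 * j) := by
    exact_mod_cast P.cube_m_le_n (2 * j) (by omega)
  have hn0 : (0 : ℝ) < P.n (2 * j) := lt_of_lt_of_le (by positivity) hn
  have h2 := half_le_normK_sum hz (fun l => (h l).2.1) hj
  set S := ∑ i ∈ Finset.range (P.n (2 * j)), z i with hS
  have h3 : (P.m (2 * j) : ℝ) / 2 ≤ P.normK S := by
    refine le_trans ?_ h2
    rw [div_le_div_iff₀ two_pos (by positivity)]
    nlinarith [pow_pos (by linarith : (0 : ℝ) < P.m (2 * j)) 2]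
  have hpos : 0 < P.normK S := by linarith
  choose y hyY hy using fun i => (h i).2.2
  refine ⟨(P.normK S)⁻¹, inv_pos.mpr hpos, ?_, nearSubspace_of_le
    (Y.sum_mem fun i (_ : i ∈ Finset.range (P.n (2 * j))) => hyY i) ?_ hpos ?_⟩
  · rw [inv_le_comm₀ hpos (by positivity), inv_div]
    exact h3
  · intro k hk
    have hk' : S k ≠ 0 := Finsupp.mem_support_iff.mp hk
    rw [hS, Finsupp.finsetSum_apply] at hk'
    obtain ⟨i, -, hi⟩ := Finset.exists_ne_zero_of_sum_ne_zero hk'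
    exact (h i).1 k (Finsupp.mem_support_iff.mpr hi)
  · rw [hS, ← toXₗ_apply, map_sum, ← Finset.sum_sub_distrib]
    refine (norm_sum_le _ _).trans ((Finset.sum_le_card_nsmul _ _ _ fun i _ => hy i).trans ?_)
    rw [Finset.card_range, nsmul_eq_mul, mul_div_cancel₀ _ hn0.ne']
    exact le_mul_of_one_le_right hη (by linarith)

/-- Successive normalized blocks sum to a vector of sup norm at most one, and normalizing multiplies
it by at most `2 / m_{2j}`, which is small for large `j`. -/
theorem exists_nearSubspace_sup_small {Y : Submodule ℝ P.X} (hY : ¬ FiniteDimensional ℝ Y) (N : ℕ)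
    {η : ℝ} (hη : 0 < η) : ∃ x, P.NearSubspace Y N η x ∧ ∀ k, |x k| ≤ η := by
  obtain ⟨j, hj, hjm⟩ := P.exists_le_m (2 / η)
  have hm : (0 : ℝ) < P.m (2 * j) := by exact_mod_cast P.one_le_m (2 * j) (by omega)
  have hn : 0 < P.n (2 * j) := lt_of_lt_of_le
    (pow_pos (P.one_le_m (2 * j) (by omega)) 3) (P.cube_m_le_n (2 * j) (by omega))
  have hn' : (0 : ℝ) < P.n (2 * j) := by exact_mod_cast hn
  obtain ⟨z, -, hz⟩ := exists_seq_of_step (α := ℕ →₀ ℝ) 0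
    (T := fun _ u z => P.NearSubspace Y N (η / P.n (2 * j)) z ∧ Before u z) fun _ u => by
      obtain ⟨M, hM⟩ := exists_support_bound u
      obtain ⟨z, hz1, hz2, hz3⟩ := exists_nearSubspace hY (max N M)
        (show 0 < η / P.n (2 * j) by positivity)
      exact ⟨z, ⟨fun k hk => (le_max_left _ _).trans (hz1 k hk), hz2, hz3⟩, fun a ha b hb =>
        (hM a ha).trans_le ((le_max_right _ _).trans (hz1 b hb))⟩
  have hblock : IsBlockSeq fun i => z (i + 1) :=
    ⟨fun l => P.ne_zero_of_normK_eq_one (hz l).1.2.1, fun l => (hz (l + 1)).2⟩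
  obtain ⟨c, hc0, hc, hnear⟩ := exists_nearSubspace_smul_sum hη.le hblock hj fun i => (hz i).1
  refine ⟨_, hnear, fun k => ?_⟩
  rw [Finsupp.smul_apply, smul_eq_mul, abs_mul, abs_of_pos hc0, Finsupp.finsetSum_apply]
  have h1 : |∑ i ∈ Finset.range (P.n (2 * j)), z (i + 1) k| ≤ 1 := by
    refine abs_sum_le_one _ _ (fun i _ => ?_) fun i _ i' _ hi hi' => ?_
    · rw [← (hz i).1.2.1]
      exact P.abs_apply_le_normK _ k
    · have hord : ∀ l l', l < l' → Before (z (l + 1)) (z (l' + 1)) := fun l l' h =>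
        hblock.before h
      exact (InHull.refl (hblock.1 i)).index_unique (x := fun i => z (i + 1)) hord
        (InHull.refl (hblock.1 i')) (Finsupp.mem_support_iff.mpr hi)
        (Finsupp.mem_support_iff.mpr hi')
  refine (mul_le_of_le_one_right hc0.le h1).trans (hc.trans ?_)
  rw [div_le_comm₀ hm hη]
  exact hjm j le_rfl

/-! ### Sums with small K̃-norm, and part (2) -/

theorem abs_pair_smul_signs_le {m : ℝ} (hm : 1 ≤ m) (F : Finset ℕ) {ε : ℕ → ℝ}
    (hε : ∀ i, ε i = 1 ∨ ε i = -1) (z : ℕ →₀ ℝ) :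
    |pair ((1 / m) • ∑ i ∈ F, Finsupp.single i (ε i)) z| ≤ 1 / m * ∑ i ∈ F, |z i| := by
  rw [pair_smul_left, pair_sum_left, abs_mul, abs_of_nonneg (by positivity)]
  refine mul_le_mul_of_nonneg_left ((Finset.abs_sum_le_sum_abs _ _).trans
    (Finset.sum_le_sum fun i _ => ?_)) (by positivity)
  rw [pair_single, abs_mul]
  have : |ε i| = 1 := by rcases hε i with e | e <;> simp [e]
  rw [this, one_mul]

theorem sum_abs_le_sum_support (F : Finset ℕ) (z : ℕ →₀ ℝ) :
    ∑ i ∈ F, |z i| ≤ ∑ i ∈ z.support, |z i| := by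
  classical
  rw [← Finset.sum_filter_add_sum_filter_not F (· ∈ z.support)]
  have h0 : ∑ i ∈ F.filter (fun i => ¬ i ∈ z.support), |z i| = 0 :=
    Finset.sum_eq_zero fun i hi => by
      rw [Finsupp.notMem_support_iff.mp (Finset.mem_filter.mp hi).2, abs_zero]
  rw [h0, add_zero]
  exact Finset.sum_le_sum_of_subset_of_nonneg (fun i hi => (Finset.mem_filter.mp hi).2)
    fun i _ _ => abs_nonneg _

/-- Block sequences with rapidly decreasing sup norms behave like the basis of `c₀` with respect
to `K̃`. -/
theorem pair_sum_le_three {z : ℕ → (ℕ →₀ ℝ)} {q : ℕ → ℕ} (hz : IsBlockSeq z)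
    (h1 : ∀ l, P.normK (z l) = 1) (hq : Monotone q)
    (hsup : ∀ i p, 1 ≤ p → p ≤ q i → ∀ k, P.n (2 * p) * |z (i + 1) k| ≤ (1 / 2 : ℝ) ^ (i + 1))
    (hl1 : ∀ i p, q i ≤ p → ∑ k ∈ (z i).support, |z i k| ≤ P.m (2 * p) * (1 / 2 : ℝ) ^ i)
    {f : ℕ →₀ ℝ} (hf : f ∈ P.Ktilde) (s : Finset ℕ) : pair f (∑ i ∈ s, z i) ≤ 3 := by
  classical
  have hle1 : ∀ i, |pair f (z i)| ≤ 1 := fun i => by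
    rw [← h1 i]
    exact P.abs_pair_le_normK (P.Ktilde_subset_K hf) _
  have hord : ∀ l l', l < l' → Before (z l) (z l') := fun l l' h => hz.before h
  -- At most one block is seen by `f` beyond its geometric allowance. A functional of weight
  -- `m_{2p}` exceeds it on `z i` only for `p < q i` (otherwise the weight beats the `ℓ₁` norm) and
  -- on `z (i + 1)` only for `p > q i` (otherwise there are too few coordinates for the sup norm);
  -- `q` is monotone.
  have huniq : ∀ i ∈ s, ∀ i' ∈ s, ¬ |pair f (z i)| ≤ (1 / 2 : ℝ) ^ i →
      ¬ |pair f (z i')| ≤ (1 / 2 : ℝ) ^ i' → i = i' := by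
    have hsingle : ∀ (k : ℕ) (c : ℝ), ∀ i i', ¬ |pair (Finsupp.single k c) (z i)| ≤ (1 / 2 : ℝ) ^ i →
        ¬ |pair (Finsupp.single k c) (z i')| ≤ (1 / 2 : ℝ) ^ i' → i = i' := by
      intro k c i i' hi hi'
      have hk : ∀ i, ¬ |pair (Finsupp.single k c) (z i)| ≤ (1 / 2 : ℝ) ^ i →
          k ∈ (z i).support := by
        intro i hi
        rw [Finsupp.mem_support_iff]
        intro h0
        refine hi ?_
        rw [pair_single, h0, mul_zero, abs_zero]
        positivity
      exact (InHull.refl (hz.1 i)).index_unique hord (InHull.refl (hz.1 i')) (hk i hi) (hk i' hi')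
    rcases hf with ⟨k, rfl | rfl⟩ | ⟨p, F, ε, hp, hF, hε, rfl⟩ | rfl
    · exact fun i _ i' _ => hsingle k 1 i i'
    · exact fun i _ i' _ => hsingle k (-1) i i'
    · have hm : (1 : ℝ) ≤ P.m (2 * p) := by exact_mod_cast P.one_le_m (2 * p) (by omega)
      have hlow : ∀ i, ¬ |pair ((1 / (P.m (2 * p) : ℝ)) • ∑ i ∈ F, Finsupp.single i (ε i)) (z i)| ≤
          (1 / 2 : ℝ) ^ i → p < q i := by
        intro i hi
        by_contra hpq
        refine hi ((abs_pair_smul_signs_le hm F hε _).trans ?_)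
        rw [one_div_mul_eq_div, div_le_iff₀ (by linarith), mul_comm]
        exact (sum_abs_le_sum_support F (z i)).trans (hl1 i p (not_lt.mp hpq))
      have hhigh : ∀ i, ¬ |pair ((1 / (P.m (2 * p) : ℝ)) • ∑ i ∈ F, Finsupp.single i (ε i))
          (z (i + 1))| ≤ (1 / 2 : ℝ) ^ (i + 1) → q i < p := by
        intro i hi
        by_contra hpq
        refine hi ((abs_pair_smul_signs_le hm F hε _).trans ?_)
        have hn : (1 : ℝ) ≤ P.n (2 * p) := by
          have h3 := P.cube_m_le_n (2 * p) (by omega)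
          have h4 := Nat.one_le_pow 3 _ (P.one_le_m (2 * p) (by omega))
          exact_mod_cast h4.trans h3
        have hb : ∀ k ∈ F, |z (i + 1) k| ≤ (1 / 2 : ℝ) ^ (i + 1) / P.n (2 * p) := fun k _ => by
          rw [le_div_iff₀ (by linarith), mul_comm]
          exact hsup i p hp (not_lt.mp hpq) k
        have hs := Finset.sum_le_card_nsmul _ _ _ hb
        rw [nsmul_eq_mul] at hs
        have hF' : (F.card : ℝ) ≤ P.n (2 * p) := by exact_mod_cast hF
        have hs' : ∑ k ∈ F, |z (i + 1) k| ≤ (1 / 2 : ℝ) ^ (i + 1) := by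
          refine hs.trans ((mul_le_mul_of_nonneg_right hF' (by positivity)).trans (le_of_eq ?_))
          field_simp
        have hm' : 1 / (P.m (2 * p) : ℝ) ≤ 1 := (div_le_one (by linarith)).mpr hm
        exact (mul_le_of_le_one_left (Finset.sum_nonneg fun _ _ => abs_nonneg _) hm').trans hs'
      have key : ∀ i i', ¬ |pair ((1 / (P.m (2 * p) : ℝ)) • ∑ i ∈ F, Finsupp.single i (ε i)) (z i)| ≤
          (1 / 2 : ℝ) ^ i → ¬ |pair ((1 / (P.m (2 * p) : ℝ)) • ∑ i ∈ F, Finsupp.single i (ε i))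
          (z i')| ≤ (1 / 2 : ℝ) ^ i' → ¬ i < i' := by
        intro i i' hi hi' hii
        obtain ⟨t, rfl⟩ : ∃ t, i' = t + 1 := ⟨i' - 1, by omega⟩
        have h3 := hq (show i ≤ t by omega)
        have h4 := hlow i hi
        have h5 := hhigh t hi'
        omega
      intro i _ i' _ hi hi'
      exact le_antisymm (not_lt.mp (key i' i hi' hi)) (not_lt.mp (key i i' hi hi'))
    · intro i _ i' _ hi
      refine (hi ?_).elim
      rw [pair_zero_left, abs_zero]
      positivity
  rw [pair_sum]
  -- The geometric allowances add up to at most `2`, and the exceptional block contributes at most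
  -- `1`.
  calc ∑ i ∈ s, pair f (z i)
      ≤ ∑ i ∈ s, ((1 / 2 : ℝ) ^ i + if ¬ |pair f (z i)| ≤ (1 / 2 : ℝ) ^ i then 1 else 0) := by
        refine Finset.sum_le_sum fun i _ => (le_abs_self _).trans ?_
        split_ifs with h
        · rw [add_zero]
          exact h
        · have : (0 : ℝ) ≤ (1 / 2 : ℝ) ^ i := by positivity
          linarith [hle1 i]
    _ ≤ 2 + 1 := by
        rw [Finset.sum_add_distrib]
        refine add_le_add ?_ (sum_ite_le_of_unique s zero_le_one huniq)
        exact (summable_geometric_two.sum_le_tsum s fun i _ => by positivity).trans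
          tsum_geometric_two.le
    _ = 3 := by norm_num

/-- The K̃-norm of a sum of rapidly flattening blocks stays below `3`, while its K-norm is at least
`m_{2j} / 2`; normalizing leaves at most `6 / m_{2j}`. -/
theorem exists_nearSubspace_normKtilde_small {Y : Submodule ℝ P.X}
    (hY : ¬ FiniteDimensional ℝ Y) (N : ℕ) {η : ℝ} (hη : 0 < η) :
    ∃ x, P.NearSubspace Y N η x ∧ P.normKtilde x ≤ η := by
  obtain ⟨j, hj, hjm⟩ := P.exists_le_m (6 / η)
  have hm : (0 : ℝ) < P.m (2 * j) := by exact_mod_cast P.one_le_m (2 * j) (by omega)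
  have hn : 0 < P.n (2 * j) := lt_of_lt_of_le
    (pow_pos (P.one_le_m (2 * j) (by omega)) 3) (P.cube_m_le_n (2 * j) (by omega))
  have hn' : (0 : ℝ) < P.n (2 * j) := by exact_mod_cast hn
  -- The recursion carries each block with its threshold `q`: the next block is flat enough for all
  -- weights up to the old threshold, and the new threshold is then chosen past the `ℓ₁` norm of the
  -- new block.
  obtain ⟨s, hs0, hs⟩ := exists_seq_of_step (α := (ℕ →₀ ℝ) × ℕ) (0, 0)
    (T := fun i u v => P.NearSubspace Y N (η / P.n (2 * j)) v.1 ∧ Before u.1 v.1 ∧ u.2 ≤ v.2 ∧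
      (∀ p, 1 ≤ p → p ≤ u.2 → ∀ k, P.n (2 * p) * |v.1 k| ≤ (1 / 2 : ℝ) ^ i) ∧
      ∀ p, v.2 ≤ p → ∑ k ∈ v.1.support, |v.1 k| ≤ P.m (2 * p) * (1 / 2 : ℝ) ^ i) fun i u => by
      obtain ⟨M, hM⟩ := exists_support_bound u.1
      have hD : (0 : ℝ) ≤ ∑ p ∈ Finset.range (u.2 + 1), (P.n (2 * p) : ℝ) :=
        Finset.sum_nonneg fun _ _ => Nat.cast_nonneg _
      -- `D` dominates every `n_{2p}` with `p ≤ u.2`; dividing by `D + 1` gives one sup bound for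
      -- all these weights.
      set D := ∑ p ∈ Finset.range (u.2 + 1), (P.n (2 * p) : ℝ)
      obtain ⟨z, ⟨hz1, hz2, y, hy, hzy⟩, hz4⟩ := exists_nearSubspace_sup_small hY (max N M)
        (show 0 < min (η / P.n (2 * j)) ((1 / 2 : ℝ) ^ i / (D + 1)) by positivity)
      obtain ⟨r, -, hr⟩ := P.exists_le_m ((∑ k ∈ z.support, |z k|) / (1 / 2 : ℝ) ^ i)
      refine ⟨(z, max u.2 r), ⟨fun k hk => (le_max_left _ _).trans (hz1 k hk), hz2, y, hy,
        hzy.trans (min_le_left _ _)⟩, fun a ha b hb =>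
        (hM a ha).trans_le ((le_max_right _ _).trans (hz1 b hb)), le_max_left _ _, ?_, ?_⟩
      · intro p _ hp k
        have h1 : (P.n (2 * p) : ℝ) ≤ D := Finset.single_le_sum (f := fun p => (P.n (2 * p) : ℝ))
          (fun _ _ => Nat.cast_nonneg _) (Finset.mem_range.mpr (Nat.lt_succ_of_le hp))
        have h2 := (hz4 k).trans (min_le_right _ _)
        calc (P.n (2 * p) : ℝ) * |z k| ≤ (D + 1) * ((1 / 2 : ℝ) ^ i / (D + 1)) :=
              mul_le_mul (by linarith) h2 (abs_nonneg _) (by linarith)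
          _ = (1 / 2 : ℝ) ^ i := by field_simp
      · intro p hp
        exact (div_le_iff₀ (by positivity)).mp (hr p ((le_max_right _ _).trans hp))
  have hnear : ∀ i, P.NearSubspace Y N (η / P.n (2 * j)) (s i).1 := by
    rintro (_ | i)
    exacts [hs0.1, (hs i).1]
  have hblock : IsBlockSeq fun i => (s i).1 :=
    ⟨fun l => P.ne_zero_of_normK_eq_one (hnear l).2.1, fun l => (hs l).2.1⟩
  obtain ⟨c, hc0, hc, hc'⟩ := exists_nearSubspace_smul_sum hη.le hblock hj hnear
  refine ⟨_, hc', P.normKtilde_le fun f hf => ?_⟩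
  have h3 := pair_sum_le_three hblock (fun l => (hnear l).2.1)
    (monotone_nat_of_le_succ fun l => (hs l).2.2.1) (fun i => (hs i).2.2.2.1)
    (by
      rintro (_ | i)
      exacts [hs0.2.2.2.2, (hs i).2.2.2.2]) hf (Finset.range (P.n (2 * j)))
  rw [pair_smul]
  have h6 : 6 / P.m (2 * j) ≤ η := by
    rw [div_le_comm₀ hm hη]
    exact hjm j le_rfl
  calc c * pair f (∑ i ∈ Finset.range (P.n (2 * j)), (s i).1)
      ≤ 2 / P.m (2 * j) * 3 :=
        (mul_le_mul_of_nonneg_left h3 hc0.le).trans (mul_le_mul_of_nonneg_right hc (by norm_num))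
    _ = 6 / P.m (2 * j) := by ring
    _ ≤ η := h6

theorem exists_unconditional_in_subspace {Y : Submodule ℝ P.X} (hY : ¬ FiniteDimensional ℝ Y) :
    ∃ y : ℕ → P.X, (∀ i, y i ∈ Y) ∧ IsUnconditionalBasicSeq y := by
  -- The errors `1 / 4 * (1 / 2) ^ i` sum to `1 / 2`, the total that the perturbation argument
  -- tolerates; the same bound makes the K̃-norms summable.
  obtain ⟨z, hz0, hz⟩ := exists_seq_of_step (α := ℕ →₀ ℝ) 0
    (T := fun i u z => P.NearSubspace Y 0 (1 / 4 * (1 / 2 : ℝ) ^ i) z ∧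
      P.normKtilde z ≤ 1 / 4 * (1 / 2 : ℝ) ^ i ∧ Before u z) fun i u => by
      obtain ⟨M, hM⟩ := exists_support_bound u
      obtain ⟨z, ⟨hz1, hz2⟩, hz3⟩ := exists_nearSubspace_normKtilde_small hY M
        (show 0 < 1 / 4 * (1 / 2 : ℝ) ^ i by positivity)
      exact ⟨z, ⟨fun k _ => Nat.zero_le k, hz2⟩, hz3, fun a ha b hb =>
        (hM a ha).trans_le (hz1 b hb)⟩
  have hnear : ∀ i, P.NearSubspace Y 0 (1 / 4 * (1 / 2 : ℝ) ^ i) (z i) ∧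
      P.normKtilde (z i) ≤ 1 / 4 * (1 / 2 : ℝ) ^ i := by
    rintro (_ | i)
    exacts [⟨hz0.1, hz0.2.1⟩, ⟨(hz i).1, (hz i).2.1⟩]
  choose y hyY hy using fun i => (hnear i).1.2.2
  have hsum : Summable fun i : ℕ => 1 / 4 * (1 / 2 : ℝ) ^ i := summable_geometric_two.mul_left _
  refine ⟨y, hyY, P.isUnconditionalBasicSeq_of_perturbation
    ⟨fun l => P.ne_zero_of_normK_eq_one (hnear l).1.2.1, fun l => (hz l).2.2⟩
    (fun l => (hnear l).1.2.1)
    (Summable.of_nonneg_of_le (fun i => P.normKtilde_nonneg _) (fun i => (hnear i).2) hsum)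
    hy fun s => ?_⟩
  refine (hsum.sum_le_tsum s fun i _ => by positivity).trans ?_
  rw [tsum_mul_left, tsum_geometric_two]
  norm_num

end Params

end Ius

theorem proposition31 (P : Ius.Params) :
    (∀ x : ℕ → (ℕ →₀ ℝ), Ius.IsBlockSeq x → (∀ l, ‖P.toX (x l)‖ = 1) →
      Filter.Tendsto (fun l => P.normKtilde (x l)) Filter.atTop (nhds 0) →
      ∃ M : ℕ → ℕ, StrictMono M ∧ Ius.IsUnconditionalBasicSeq (fun i => P.toX (x (M i)))) ∧
    (∀ Y : Submodule ℝ P.X, ¬ FiniteDimensional ℝ Y →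
      ∃ y : ℕ → P.X, (∀ i, y i ∈ Y) ∧ Ius.IsUnconditionalBasicSeq y) :=
  ⟨fun _ hx h1 h0 => P.exists_unconditional_subsequence hx
      (fun l => (P.norm_toX _).symm.trans (h1 l)) h0,
    fun _ hY => Ius.Params.exists_unconditional_in_subspace hY⟩
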